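/- Let $\mathbb{Z}_2^2=\mathbb{Z}_2\times\mathbb{Z}_2$ and $\boldsymbol a\cdot\boldsymbol b=a_1b_1+a_2b_2$. A $\mathbb{Z}_2^2$-graded Lie superalgebra is a complex vector space $\mathfrak g=\bigoplus_{\boldsymbol a}\mathfrak g_{\boldsymbol a}$ with a bilinear bracket such that, for $X,Y,Z$ homogeneous of degrees $\boldsymbol a,\boldsymbol b,\boldsymbol c$, one has $[\![X,Y]\!]\in\mathfrak g_{\boldsymbol a+\boldsymbol b}$, $[\![X,Y]\!]=-(-1)^{\boldsymbol a\cdot\boldsymbol b}[\![Y,X]\!]$ and $$(-1)^{\boldsymbol a\cdot\boldsymbol c}[\![X,[\![Y,Z]\!]]\!]+(-1)^{\boldsymbol b\cdot\boldsymbol a}[\![Y,[\![Z,X]\!]]\!]+(-1)^{\boldsymbol c\cdot\boldsymbol b}[\![Z,[\![X,Y]\!]]\!]=0 .$$ Let $\mathfrak g^{10}$ (the ten-dimensional $\mathbb{Z}_2^2$-graded $osp(1|2)$) have the basis $L^\pm,R$ of degree $(0,0)$, $\tilde L^\pm,\tilde R$ of degree $(1,1)$, $a^\pm$ of degree $(0,1)$,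 $\tilde a^\pm$ of degree $(1,0)$, with the relations (all other brackets of basis vectors vanish, apart from those following by graded antisymmetry) $[\![R,L^\pm]\!]=\pm2L^\pm$, $[\![R,\tilde L^\pm]\!]=\pm2\tilde L^\pm$, $[\![R,a^\pm]\!]=\pm a^\pm$, $[\![R,\tilde a^\pm]\!]=\pm\tilde a^\pm$, $[\![\tilde R,L^\pm]\!]=\pm2\tilde L^\pm$, $[\![\tilde R,\tilde L^\pm]\!]=\pm2L^\pm$, $[\![\tilde R,a^\pm]\!]=\tilde a^\pm$, $[\![\tilde R,\tilde a^\pm]\!]=a^\pm$, $[\![L^+,L^-]\!]=-R$, $[\![L^\pm,\tilde L^\mp]\!]=\mp\tilde R$, $[\![\tilde L^+,\tilde L^-]\!]=-R$, $[\![L^\pm,\tilde a^\mp]\!]=\pm\tilde a^\pm$, $[\![L^\pm,a^\mp]\!]=\mp a^\pm$, $[\![\tilde L^\pm,a^\mp]\!]=-\tilde a^\pm$, $[\![\tilde L^\pm,\tilde a^\mp]\!]=a^\pm$, $[\![a^+,a^-]\!]=2R$, $[\![a^\pm,\tilde a^\mp]\!]=\pm2\tilde R$, $[\![\tilde a^+,\tilde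 a^-]\!]=2R$, $[\![a^\pm,\tilde a^\pm]\!]=\mp4\tilde L^\pm$, $[\![a^\pm,a^\pm]\!]=4L^\pm$, $[\![\tilde a^\pm,\tilde a^\pm]\!]=-4L^\pm$. Write $X^1,\dots,X^{10}$ for the basis $(L^+,R,L^-,\tilde L^+,\tilde R,\tilde L^-,a^+,a^-,\tilde a^+,\tilde a^-)$, $\boldsymbol a=\deg X^a$, $\mathrm{ad}\,X^a$ for the matrix of $Y\mapsto[\![X^a,Y]\!]$, and $\mathrm{Str}$ for the graded supertrace (diagonal entries in degrees $(0,0),(1,1)$ count with $+$, those in degrees $(0,1),(1,0)$ with $-$). Let $g^{ab}=\mathrm{Str}(\mathrm{ad}X^a\,\mathrm{ad}X^b)$ be the graded Killing form and $\eta^{ab}=\mathrm{Str}(\mathrm{ad}X^a\,M\,\mathrm{ad}X^b)$ the $(1,1)$-graded invariant form, where $M$ is the matrix of degree $(1,1)$ whose linear map exchanges $L^\pm\leftrightarrow\tilde L^\pm$ and $R\leftrightarrow\tilde R$ and sends $a^\pm\mapsto\pm\tilde a^\pm$, $\tilde a^\pm\mapsto\pm a^\pm$. Let $L(\mathfrak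 g^{10})=\mathfrak g^{10}\otimes\mathbb C[\lambda,\lambda^{-1}]$, with $X^a_m=\lambda^m\otimes X^a$ of degree $\boldsymbol a$ and the bracket extended bilinearly over $\mathbb C[\lambda,\lambda^{-1}]$. **Theorem.** $L(\mathfrak g^{10})$ is a $\mathbb{Z}_2^2$-graded Lie superalgebra, and the following hold. 1. Let $V=\bigoplus_{\boldsymbol a}V_{\boldsymbol a}$ be any $\mathbb Z_2^2$-graded complex vector space. For $\omega_{00}\in V_{(0,0)}$ and $\omega_{11}\in V_{(1,1)}$, the bracket $[\![x+u,y+v]\!]=[\![x,y]\!]+\omega(x,y)$ on $L(\mathfrak g^{10})\oplus V$, where $$\omega(X^a_m,X^b_n)=\bigl(g^{ab}\,\omega_{00}+(-1)^{\boldsymbol a\cdot(1,1)}\eta^{ab}\,\omega_{11}\bigr)\,m\,\delta_{m+n,0},$$ defines a $\mathbb Z_2^2$-graded central extension of $L(\mathfrak g^{10})$ by $V$. Every $\mathbb Z_2^2$-graded central extension $0\to V\to E\to L(\mathfrak g^{10})\to0$ is equivalent to this one for exactly one pair $(\omega_{00},\omega_{11})\in V_{(0,0)}\times V_{(1,1)}$.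 (All maps preserve degrees; equivalence means a degree-preserving isomorphism of algebras compatible with the maps from $V$ and to $L(\mathfrak g^{10})$.) 2. There are exactly two independent scalar central extensions. The scalar forms $g^{ab}m\delta_{m+n,0}$, of degree $(0,0)$, and $(-1)^{\boldsymbol a\cdot(1,1)}\eta^{ab}m\delta_{m+n,0}$, of degree $(1,1)$, are 2-cocycles, and their classes form a basis of $H^2(L(\mathfrak g^{10}),\mathbb C)=Z^2/B^2$. Here $Z^2$ consists of the bilinear forms $\omega$ such that, for homogeneous $X,Y,Z$ as above, $\omega(X,Y)=-(-1)^{\boldsymbol a\cdot\boldsymbol b}\omega(Y,X)$ and $(-1)^{\boldsymbol a\cdot\boldsymbol c}\omega(X,[\![Y,Z]\!])+(-1)^{\boldsymbol b\cdot\boldsymbol a}\omega(Y,[\![Z,X]\!])+(-1)^{\boldsymbol c\cdot\boldsymbol b}\omega(Z,[\![X,Y]\!])=0$, and $B^2$ of the forms $(X,Y)\mapsto f([\![X,Y]\!])$ with $f$ linear. -/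

import Mathlib

open scoped TensorProduct
open Module

universe u v

/-! ### `ℤ₂²`-graded Lie superalgebras and their central extensions -/

/-- The grading group `ℤ₂ × ℤ₂`. -/
abbrev Z22 : Type := ZMod 2 × ZMod 2

/-- The sign `(-1)^{a·b}` with `a·b = a₁b₁ + a₂b₂`. -/
def sgn (a b : Z22) : ℤ := (-1) ^ (a.1 * b.1 + a.2 * b.2).val

/-- `br` makes the complex vector space `A = ⨁ₐ 𝒜 a` a `ℤ₂²`-graded Lie superalgebra. -/
structure IsZ22LieSuperalgebra {A : Type*} [AddCommGroup A] [Module ℂ A]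
    (𝒜 : Z22 → Submodule ℂ A) (br : A →ₗ[ℂ] A →ₗ[ℂ] A) : Prop where
  isInternal : DirectSum.IsInternal 𝒜
  bracket_mem : ∀ (a b : Z22) (x y : A), x ∈ 𝒜 a → y ∈ 𝒜 b → br x y ∈ 𝒜 (a + b)
  skew : ∀ (a b : Z22) (x y : A), x ∈ 𝒜 a → y ∈ 𝒜 b → br x y = -(sgn a b • br y x)
  jacobi : ∀ (a b c : Z22) (x y z : A), x ∈ 𝒜 a → y ∈ 𝒜 b → z ∈ 𝒜 c →
    sgn a c • br x (br y z) + sgn b a • br y (br z x) + sgn c b • br z (br x y) = 0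

/-- `0 → V → E → L → 0` (with maps `ι`, `π`) is a `ℤ₂²`-graded central extension of the graded
algebra `(L, 𝓛, brL)` by the graded vector space `(V, 𝒱)`. -/
structure IsGradedCentralExtension {L V E : Type*}
    [AddCommGroup L] [Module ℂ L] [AddCommGroup V] [Module ℂ V] [AddCommGroup E] [Module ℂ E]
    (𝓛 : Z22 → Submodule ℂ L) (brL : L →ₗ[ℂ] L →ₗ[ℂ] L) (𝒱 : Z22 → Submodule ℂ V)
    (ℰ : Z22 → Submodule ℂ E) (brE : E →ₗ[ℂ] E →ₗ[ℂ] E)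
    (ι : V →ₗ[ℂ] E) (π : E →ₗ[ℂ] L) : Prop where
  lie : IsZ22LieSuperalgebra ℰ brE
  ι_mem : ∀ (a : Z22) (v : V), v ∈ 𝒱 a → ι v ∈ ℰ a
  π_mem : ∀ (a : Z22) (e : E), e ∈ ℰ a → π e ∈ 𝓛 a
  injective : Function.Injective ι
  exact : LinearMap.range ι = LinearMap.ker π
  surjective : Function.Surjective π
  map_bracket : ∀ e e' : E, π (brE e e') = brL (π e) (π e')
  central : ∀ (e : E) (v : V), brE e (ι v) = 0

/-- Equivalence of two extensions of `L` by `V`: a degree preserving isomorphism of algebras that is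
compatible with the maps from `V` and to `L`. -/
def ExtensionEquivalent {L V E E' : Type*}
    [AddCommGroup L] [Module ℂ L] [AddCommGroup V] [Module ℂ V]
    [AddCommGroup E] [Module ℂ E] [AddCommGroup E'] [Module ℂ E']
    (ℰ : Z22 → Submodule ℂ E) (brE : E →ₗ[ℂ] E →ₗ[ℂ] E) (ι : V →ₗ[ℂ] E) (π : E →ₗ[ℂ] L)
    (ℰ' : Z22 → Submodule ℂ E') (brE' : E' →ₗ[ℂ] E' →ₗ[ℂ] E') (ι' : V →ₗ[ℂ] E')
    (π' : E' →ₗ[ℂ] L) : Prop :=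
  ∃ φ : E ≃ₗ[ℂ] E',
    (∀ (a : Z22) (e : E), e ∈ ℰ a → φ e ∈ ℰ' a) ∧
    (∀ e₁ e₂ : E, φ (brE e₁ e₂) = brE' (φ e₁) (φ e₂)) ∧
    (∀ v : V, φ (ι v) = ι' v) ∧
    (∀ e : E, π' (φ e) = π e)

/-- The bracket `⟦(x, u), (y, v)⟧ = (⟦x, y⟧, ω(x, y))` on `L ⊕ V`. -/
def extBracket {L V : Type*} [AddCommGroup L] [Module ℂ L] [AddCommGroup V] [Module ℂ V]
    (br : L →ₗ[ℂ] L →ₗ[ℂ] L) (ω : L →ₗ[ℂ] L →ₗ[ℂ] V) :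
    (L × V) →ₗ[ℂ] (L × V) →ₗ[ℂ] (L × V) :=
  LinearMap.mk₂ ℂ (fun p q => (br p.1 q.1, ω p.1 q.1))
    (fun p p' q => by simp) (fun c p q => by simp) (fun p q q' => by simp) (fun c p q => by simp)

/-- The grading `(L ⊕ V)_a = L_a ⊕ V_a`. -/
def extGrading {L V : Type*} [AddCommGroup L] [Module ℂ L] [AddCommGroup V] [Module ℂ V]
    (𝓛 : Z22 → Submodule ℂ L) (𝒱 : Z22 → Submodule ℂ V) (a : Z22) : Submodule ℂ (L × V) :=
  (𝓛 a).prod (𝒱 a)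

/-! ### The second cohomology group with trivial coefficients `ℂ` -/

/-- The space `Z²` of scalar 2-cocycles of a graded algebra. -/
def cocycles {L : Type*} [AddCommGroup L] [Module ℂ L]
    (𝓛 : Z22 → Submodule ℂ L) (br : L →ₗ[ℂ] L →ₗ[ℂ] L) : Submodule ℂ (L →ₗ[ℂ] L →ₗ[ℂ] ℂ) where
  carrier := {ω |
    (∀ (a b : Z22) (x y : L), x ∈ 𝓛 a → y ∈ 𝓛 b → ω x y = -(sgn a b • ω y x)) ∧
    (∀ (a b c : Z22) (x y z : L), x ∈ 𝓛 a → y ∈ 𝓛 b → z ∈ 𝓛 c →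
      sgn a c • ω x (br y z) + sgn b a • ω y (br z x) + sgn c b • ω z (br x y) = 0)}
  zero_mem' := by constructor <;> intros <;> simp
  add_mem' := by
    rintro ω ω' ⟨h1, h2⟩ ⟨h1', h2'⟩
    refine ⟨fun a b x y hx hy => ?_, fun a b c x y z hx hy hz => ?_⟩
    · simp only [LinearMap.add_apply, h1 a b x y hx hy, h1' a b x y hx hy, smul_add, neg_add]
    · have h := h2 a b c x y z hx hy hz
      have h' := h2' a b c x y z hx hy hz
      simp only [LinearMap.add_apply, smul_add]
      linear_combination h + h'
  smul_mem' := by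
    rintro t ω ⟨h1, h2⟩
    refine ⟨fun a b x y hx hy => ?_, fun a b c x y z hx hy hz => ?_⟩
    · simp only [LinearMap.smul_apply, h1 a b x y hx hy, smul_eq_mul, zsmul_eq_mul]
      ring
    · have h := h2 a b c x y z hx hy hz
      simp only [LinearMap.smul_apply, smul_eq_mul, zsmul_eq_mul] at h ⊢
      linear_combination t * h

/-- The space `B²` of scalar 2-coboundaries `(x, y) ↦ f ⟦x, y⟧`, `f : L → ℂ` linear. -/
def coboundaries {L : Type*} [AddCommGroup L] [Module ℂ L]
    (br : L →ₗ[ℂ] L →ₗ[ℂ] L) : Submodule ℂ (L →ₗ[ℂ] L →ₗ[ℂ] ℂ) where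
  carrier := {ω | ∃ f : L →ₗ[ℂ] ℂ, ∀ x y : L, ω x y = f (br x y)}
  zero_mem' := ⟨0, by simp⟩
  add_mem' := by
    rintro ω ω' ⟨f, hf⟩ ⟨f', hf'⟩
    exact ⟨f + f', fun x y => by simp [hf, hf']⟩
  smul_mem' := by
    rintro t ω ⟨f, hf⟩
    exact ⟨t • f, fun x y => by simp [hf]⟩

/-- `H² = Z² / B²`, realised as the image of `Z²` in the quotient of all bilinear forms by `B²`. -/
abbrev H2 {L : Type*} [AddCommGroup L] [Module ℂ L]
    (𝓛 : Z22 → Submodule ℂ L) (br : L →ₗ[ℂ] L →ₗ[ℂ] L) :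
    Submodule ℂ ((L →ₗ[ℂ] L →ₗ[ℂ] ℂ) ⧸ coboundaries br) :=
  (cocycles 𝓛 br).map (coboundaries br).mkQ

/-- A scalar bilinear form of degree `c` (it vanishes on `L_a × L_b` unless `a + b = c`). -/
def HasDegree {L : Type*} [AddCommGroup L] [Module ℂ L]
    (𝓛 : Z22 → Submodule ℂ L) (c : Z22) (ω : L →ₗ[ℂ] L →ₗ[ℂ] ℂ) : Prop :=
  ∀ (a b : Z22) (x y : L), x ∈ 𝓛 a → y ∈ 𝓛 b → a + b ≠ c → ω x y = 0

/-! ### The ten dimensional `ℤ₂²`-graded `osp(1|2)` -/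

namespace Osp

/-- The basis: `Lp, Lm = L^±`, `Kp, Km = L̃^±`, `S = R̃`, `ap, am = a^±`, `bp, bm = ã^±`. -/
inductive Idx : Type
  | Lp | R | Lm | Kp | S | Km | ap | am | bp | bm
  deriving DecidableEq

open Idx

instance : Fintype Idx :=
  ⟨{Lp, R, Lm, Kp, S, Km, ap, am, bp, bm}, fun x => by cases x <;> decide⟩

/-- The degree of a basis vector. -/
def deg : Idx → Z22
  | Lp | R | Lm => (0, 0)
  | Kp | S | Km => (1, 1)
  | ap | am => (0, 1)
  | bp | bm => (1, 0)

/-- The defining relations; each unordered pair with non-vanishing bracket is listed once. -/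
def rel : Idx → Idx → Idx → ℤ
  | R, Lp => Pi.single Lp 2
  | R, Lm => Pi.single Lm (-2)
  | R, Kp => Pi.single Kp 2
  | R, Km => Pi.single Km (-2)
  | R, ap => Pi.single ap 1
  | R, am => Pi.single am (-1)
  | R, bp => Pi.single bp 1
  | R, bm => Pi.single bm (-1)
  | S, Lp => Pi.single Kp 2
  | S, Lm => Pi.single Km (-2)
  | S, Kp => Pi.single Lp 2
  | S, Km => Pi.single Lm (-2)
  | S, ap => Pi.single bp 1
  | S, am => Pi.single bm 1
  | S, bp => Pi.single ap 1
  | S, bm => Pi.single am 1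
  | Lp, Lm => Pi.single R (-1)
  | Lp, Km => Pi.single S (-1)
  | Lm, Kp => Pi.single S 1
  | Kp, Km => Pi.single R (-1)
  | Lp, bm => Pi.single bp 1
  | Lm, bp => Pi.single bm (-1)
  | Lp, am => Pi.single ap (-1)
  | Lm, ap => Pi.single am 1
  | Kp, am => Pi.single bp (-1)
  | Km, ap => Pi.single bm (-1)
  | Kp, bm => Pi.single ap 1
  | Km, bp => Pi.single am 1
  | ap, am => Pi.single R 2
  | ap, bm => Pi.single S 2
  | am, bp => Pi.single S (-2)
  | bp, bm => Pi.single R 2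
  | ap, bp => Pi.single Kp (-4)
  | am, bm => Pi.single Km 4
  | ap, ap => Pi.single Lp 4
  | am, am => Pi.single Lm 4
  | bp, bp => Pi.single Lp (-4)
  | bm, bm => Pi.single Lm (-4)
  | _, _ => 0

/-- The structure constants `f^{ab}_c`: the relations completed by graded antisymmetry
`f^{ab}_c = -(-1)^{a·b} f^{ba}_c`. -/
def f (a b c : Idx) : ℤ :=
  if a = b then rel a a c else rel a b c - sgn (deg a) (deg b) * rel b a c

/-- The underlying vector space of `𝔤¹⁰`. -/
abbrev G10 : Type := Idx → ℂ

/-- The basis vector `X^a`. -/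
noncomputable def X (a : Idx) : G10 := Pi.single a 1

/-- The grading of `𝔤¹⁰`. -/
def grading (d : Z22) : Submodule ℂ G10 := Submodule.span ℂ {x | ∃ a, deg a = d ∧ x = X a}

/-- The bilinear bracket of `𝔤¹⁰` with `⟦X^a, X^b⟧ = ∑_c f^{ab}_c X^c`. -/
noncomputable def bracket : G10 →ₗ[ℂ] G10 →ₗ[ℂ] G10 :=
  (Pi.basisFun ℂ Idx).constr ℂ fun a => (Pi.basisFun ℂ Idx).constr ℂ fun b =>
    ∑ c, (f a b c : ℂ) • X c

/-- The matrix of `ad X^a` in the adjoint representation, `(ad X^a)_{ij} = f^{aj}_i`. -/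
def ad (a : Idx) : Matrix Idx Idx ℤ := Matrix.of fun i j => f a j i

/-- The `ℤ₂²`-graded supertrace: the diagonal blocks of degrees `(0,0)`, `(1,1)` count with `+`,
those of degrees `(0,1)`, `(1,0)` with `-`. -/
def str (N : Matrix Idx Idx ℤ) : ℤ := ∑ i, sgn (deg i) (deg i) * N i i

/-- The matrix of degree `(1,1)` with blocks `I₃, I₃, σ₃, σ₃` off the diagonal. -/
def M : Matrix Idx Idx ℤ := Matrix.of fun i j =>
  match i, j with
  | Lp, Kp | R, S | Lm, Km | Kp, Lp | S, R | Km, Lm => 1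
  | ap, bp | bp, ap => 1
  | am, bm | bm, am => -1
  | _, _ => 0

/-- The graded Killing form `g^{ab} = Str(ad X^a ad X^b)`. -/
def g (a b : Idx) : ℤ := str (ad a * ad b)

/-- The `(1,1)`-graded invariant form `η^{ab} = Str(ad X^a M ad X^b)`. -/
def eta (a b : Idx) : ℤ := str (ad a * M * ad b)

/-! ### The loop algebra `L(𝔤¹⁰) = 𝔤¹⁰ ⊗ ℂ[λ, λ⁻¹]` -/

/-- The underlying vector space of the loop algebra. -/
abbrev Loop : Type := LaurentPolynomial ℂ ⊗[ℂ] G10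

/-- `X^a_m = λ^m ⊗ X^a`. -/
noncomputable def XL (m : ℤ) (a : Idx) : Loop := LaurentPolynomial.T m ⊗ₜ[ℂ] X a

/-- The grading `L(𝔤)_d = ℂ[λ, λ⁻¹] ⊗ 𝔤_d`. -/
noncomputable def loopGrading (d : Z22) : Submodule ℂ Loop :=
  LinearMap.range ((grading d).subtype.lTensor (LaurentPolynomial ℂ))

/-- The bracket `⟦p ⊗ x, q ⊗ y⟧ = pq ⊗ ⟦x, y⟧`. -/
noncomputable def loopBracket : Loop →ₗ[ℂ] Loop →ₗ[ℂ] Loop :=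
  TensorProduct.map₂ (LinearMap.mul ℂ (LaurentPolynomial ℂ)) bracket

/-- The basis `X^a_m` of the loop algebra. -/
noncomputable def loopBasis : Basis (ℤ × Idx) ℂ Loop :=
  (AddMonoidAlgebra.basis ℤ ℂ).tensorProduct (Pi.basisFun ℂ Idx)

/-- The bilinear map
`ω(X^a_m, X^b_n) = (g^{ab} ω₀₀ + (-1)^{a·(1,1)} η^{ab} ω₁₁) m δ_{m+n,0}`. -/
noncomputable def affineCocycle {V : Type*} [AddCommGroup V] [Module ℂ V] (ω₀₀ ω₁₁ : V) :
    Loop →ₗ[ℂ] Loop →ₗ[ℂ] V :=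
  loopBasis.constr ℂ fun p => loopBasis.constr ℂ fun q =>
    if p.1 + q.1 = 0 then
      p.1 • (g p.2 q.2 • ω₀₀ + (sgn (deg p.2) (1, 1) * eta p.2 q.2) • ω₁₁)
    else 0

theorem loopBasis_apply (m : ℤ) (a : Idx) : loopBasis (m, a) = XL m a := by
  rw [loopBasis, Basis.tensorProduct_apply]
  simp [XL, X, LaurentPolynomial.T, -LaurentPolynomial.single_eq_C_mul_T]

theorem bracket_X (a b : Idx) : bracket (X a) (X b) = ∑ c, (f a b c : ℂ) • X c := by
  have h : ∀ a, X a = Pi.basisFun ℂ Idx a := fun a => by simp [X]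
  rw [h a, h b, bracket, Basis.constr_basis, Basis.constr_basis]

theorem loopBracket_XL (m n : ℤ) (a b : Idx) :
    loopBracket (XL m a) (XL n b) = ∑ c, (f a b c : ℂ) • XL (m + n) c := by
  simp only [loopBracket, XL, TensorProduct.map₂_apply_tmul, TensorProduct.map_tmul, bracket_X,
    TensorProduct.tmul_sum, TensorProduct.tmul_smul, LinearMap.mul_apply', LaurentPolynomial.T_add]

theorem affineCocycle_XL {V : Type*} [AddCommGroup V] [Module ℂ V] (ω₀₀ ω₁₁ : V)
    (m n : ℤ) (a b : Idx) :
    affineCocycle ω₀₀ ω₁₁ (XL m a) (XL n b) =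
      if m + n = 0 then m • (g a b • ω₀₀ + (sgn (deg a) (1, 1) * eta a b) • ω₁₁) else 0 := by
  rw [← loopBasis_apply, ← loopBasis_apply, affineCocycle, Basis.constr_basis, Basis.constr_basis]

end Osp

/-! Degrees (0,0) and (1,1) have trivial mutual signs, so the even part of the loop algebra is an
ordinary Lie algebra: it is sl₂ ⊗ A with A = ℂ[λ, λ⁻¹, θ]/(θ² - 1), the group ring of ℤ × ℤ/2, where
θ turns x into x̃. As for any sl₂ ⊗ A, a 2-cocycle reduces modulo coboundaries to a form ρ on A, its
value on pairs of multiples of R, and the Jacobi identity says that ρ is a cyclic 1-cocycle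
(`rr_cyclic`). For fixed total index s, the map x ↦ ρ(x, s - x) is additive on ℤ × ℤ/2. It kills the
torsion and vanishes at s, so ρ is a residue with one free vector for each power of θ
(`cyclic_cocycle_eq`). These are the two parameters.

The rest of the cocycle is forced. Pairs of nonzero total weight for ad R vanish after normalization
(`eq_zero_of_wt`). The pairs (L⁺θ^i, L⁻θ^j) are half of values of ρ, and the Jacobi identities with
zero modes of S and L⁺ reduce the odd pairs to ρ as well (`ap_am`, `ap_bm`). Conversely, the two
forms are cocycles because the Killing form and the signed η are invariant, while the modes of a
nonzero term add up to 0.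

For extensions, a degree-preserving linear section yields a cocycle, and a graded linear form turns
cohomology into equivalence. The parameters are unique because R commutes with R and S at all modes:
every coboundary vanishes on the pairs (R_1, R_{-1}) and (R_1, S_{-1}), where the affine cocycle
takes the values 12 ω₀₀ and 12 ω₁₁. -/

/-! ### Homogeneous components -/

section Components

variable {A B : Type*} [AddCommGroup A] [Module ℂ A] [AddCommGroup B] [Module ℂ B]

/-- `P d` is the projection of `A = ⨁ 𝒜 d` to its component of degree `d`. -/
structure IsComponentFamily (𝒜 : Z22 → Submodule ℂ A) (P : Z22 → A →ₗ[ℂ] A) : Prop where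
  mem : ∀ d x, P d x ∈ 𝒜 d
  eq_self : ∀ d x, x ∈ 𝒜 d → P d x = x
  eq_zero : ∀ d d' x, d ≠ d' → x ∈ 𝒜 d' → P d x = 0
  sum_eq : ∀ x, ∑ d, P d x = x

theorem exists_isComponentFamily {𝒜 : Z22 → Submodule ℂ A} (h : DirectSum.IsInternal 𝒜) :
    ∃ P, IsComponentFamily 𝒜 P := by
  let e := LinearEquiv.ofBijective (DirectSum.coeLinearMap 𝒜) h
  have he : ∀ d (x : 𝒜 d), e.symm x = DirectSum.lof ℂ Z22 (fun d => 𝒜 d) d x := fun d x => by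
    rw [LinearEquiv.symm_apply_eq]
    exact (DirectSum.coeLinearMap_lof 𝒜 d x).symm
  refine ⟨fun d => (𝒜 d).subtype ∘ₗ DirectSum.component ℂ Z22 (fun d => 𝒜 d) d ∘ₗ
    e.symm.toLinearMap, fun d x => by simp, fun d x hx => ?_, fun d d' x hd hx => ?_, fun x => ?_⟩
  · have := he d ⟨x, hx⟩
    simp only at this
    simp [this]
  · have := he d' ⟨x, hx⟩
    simp only at this
    simp [this, DirectSum.component.of, hd.symm]
  · obtain ⟨y, rfl⟩ := e.surjective x
    simp only [LinearMap.comp_apply, Submodule.subtype_apply, LinearEquiv.coe_coe,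
      LinearEquiv.symm_apply_apply]
    induction y using DirectSum.induction_on with
    | zero => simp
    | of d x =>
      rw [Finset.sum_eq_single d]
      · refine Eq.trans ?_ (DirectSum.coeLinearMap_lof 𝒜 d x).symm
        exact congrArg Subtype.val (DirectSum.of_eq_same (β := fun d => 𝒜 d) d x)
      · intro d' _ hd
        exact congrArg Subtype.val (DirectSum.of_eq_of_ne (β := fun d => 𝒜 d) d d' x hd)
      · simp
    | add x y hx hy => simp only [map_add, Submodule.coe_add, Finset.sum_add_distrib, hx, hy]

theorem isInternal_of_isComponentFamily {𝒜 : Z22 → Submodule ℂ A} {P : Z22 → A →ₗ[ℂ] A}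
    (h : IsComponentFamily 𝒜 P) : DirectSum.IsInternal 𝒜 := by
  apply DirectSum.isInternal_submodule_of_iSupIndep_of_iSup_eq_top
  · intro d
    rw [Submodule.disjoint_def]
    intro x hx hx'
    have hle : (⨆ j, ⨆ (_ : j ≠ d), 𝒜 j) ≤ LinearMap.ker (P d) :=
      iSup₂_le fun j hj y hy => h.eq_zero d j y hj.symm hy
    rw [← h.eq_self d x hx]
    exact hle hx'
  · rw [eq_top_iff]
    intro x _
    rw [← h.sum_eq x]
    exact Submodule.sum_mem _ fun d _ => Submodule.mem_iSup_of_mem d (h.mem d x)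

theorem IsComponentFamily.map_apply {𝒜 : Z22 → Submodule ℂ A} {P : Z22 → A →ₗ[ℂ] A}
    {ℬ : Z22 → Submodule ℂ B} {Q : Z22 → B →ₗ[ℂ] B} (hP : IsComponentFamily 𝒜 P)
    (hQ : IsComponentFamily ℬ Q) {φ : A →ₗ[ℂ] B} (hφ : ∀ d x, x ∈ 𝒜 d → φ x ∈ ℬ d)
    (d : Z22) (x : A) : Q d (φ x) = φ (P d x) := by
  conv_lhs => rw [← hP.sum_eq x, map_sum, map_sum]
  rw [Finset.sum_eq_single d]
  · exact hQ.eq_self _ _ (hφ _ _ (hP.mem _ _))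
  · exact fun d' _ hd => hQ.eq_zero _ _ _ hd.symm (hφ _ _ (hP.mem _ _))
  · simp

theorem isInternal_extGrading {𝒜 : Z22 → Submodule ℂ A} {ℬ : Z22 → Submodule ℂ B}
    (hA : DirectSum.IsInternal 𝒜) (hB : DirectSum.IsInternal ℬ) :
    DirectSum.IsInternal (extGrading 𝒜 ℬ) := by
  obtain ⟨P, hP⟩ := exists_isComponentFamily hA
  obtain ⟨Q, hQ⟩ := exists_isComponentFamily hB
  refine isInternal_of_isComponentFamily (P := fun d => (P d).prodMap (Q d))
    ⟨fun d x => ⟨hP.mem _ _, hQ.mem _ _⟩, fun d x hx => ?_, fun d d' x hd hx => ?_, fun x => ?_⟩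
  · exact Prod.ext (hP.eq_self _ _ hx.1) (hQ.eq_self _ _ hx.2)
  · exact Prod.ext (hP.eq_zero _ _ _ hd hx.1) (hQ.eq_zero _ _ _ hd hx.2)
  · ext
    · simp [Prod.fst_sum, hP.sum_eq]
    · simp [Prod.snd_sum, hQ.sum_eq]

end Components

theorem sgn_comm (a b : Z22) : sgn a b = sgn b a := by
  simp only [sgn, mul_comm]

namespace Osp

open Idx

/-! ### Structure constants -/

/-- The eigenvalue of `ad R`. -/
def wt : Idx → ℤ
  | Lp | Kp => 2
  | R | S => 0
  | Lm | Km => -2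
  | ap | bp => 1
  | am | bm => -1

/-- The basis vector of degree `d` and weight `w`, if there is one. -/
def ofDegWt (d : Z22) (w : ℤ) : Idx :=
  if d = (0, 0) then if w = 2 then Lp else if w = 0 then R else Lm
  else if d = (1, 1) then if w = 2 then Kp else if w = 0 then S else Km
  else if d = (0, 1) then if w = 1 then ap else am
  else if w = 1 then bp else bm

/-- The basis vector of which `⟦X^a, X^b⟧` is a multiple. -/
def tgt (a b : Idx) : Idx := ofDegWt (deg a + deg b) (wt a + wt b)

/-- The coefficient in `⟦X^a, X^b⟧ = coef a b • X^{tgt a b}`. -/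
def coef (a b : Idx) : ℤ := f a b (tgt a b)

-- Degree and weight together separate the basis vectors, and both are additive under the bracket,
-- so a bracket of basis vectors has at most one term. When no basis vector has the required degree
-- and weight, `tgt` is a default value and `coef` is 0.
set_option maxRecDepth 100000 in
theorem f_eq (a b c : Idx) : f a b c = if c = tgt a b then coef a b else 0 := by
  revert a b c; decide

set_option maxRecDepth 100000 in
theorem coef_skew (a b : Idx) : coef a b = -(sgn (deg a) (deg b) * coef b a) := by
  revert a b; decide

theorem tgt_comm (a b : Idx) : tgt a b = tgt b a := by
  simp only [tgt, add_comm]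

set_option maxRecDepth 100000 in
theorem deg_tgt (a b : Idx) (h : coef a b ≠ 0) : deg (tgt a b) = deg a + deg b := by
  revert a b; decide

set_option maxRecDepth 100000 in
theorem wt_tgt (a b : Idx) (h : coef a b ≠ 0) : wt (tgt a b) = wt a + wt b := by
  revert a b; decide

theorem coef_R (a : Idx) : coef R a = wt a := by
  revert a; decide

set_option maxRecDepth 100000 in
theorem tgt_R (a : Idx) : tgt R a = a := by
  revert a; decide

/-- The coefficient of `X^e` in `c • X^d`. -/
def single (c : ℤ) (d e : Idx) : ℤ := if e = d then c else 0

/-- The three targets can differ when a coefficient vanishes, since `tgt` is then a default value.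
The identity is therefore compared on each basis vector `e`, which leaves a finite check. -/
theorem jacobi_coef (a b c e : Idx) :
    single (sgn (deg a) (deg c) * coef b c * coef a (tgt b c)) (tgt a (tgt b c)) e
    + single (sgn (deg b) (deg a) * coef c a * coef b (tgt c a)) (tgt b (tgt c a)) e
    + single (sgn (deg c) (deg b) * coef a b * coef c (tgt a b)) (tgt c (tgt a b)) e = 0 := by
  revert a b c e; decide +kernel

/-! ### The graded algebra structure of the loop algebra -/

theorem loopGrading_eq_span (d : Z22) :
    loopGrading d = Submodule.span ℂ {x | ∃ m a, deg a = d ∧ x = XL m a} := by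
  apply le_antisymm
  · rintro _ ⟨t, rfl⟩
    induction t using TensorProduct.induction_on with
    | zero => simp
    | add x y hx hy => rw [map_add]; exact add_mem hx hy
    | tmul p x =>
      obtain ⟨x, hx⟩ := x
      rw [LinearMap.lTensor_tmul, Submodule.subtype_apply]
      simp only
      induction hx using Submodule.span_induction with
      | zero => simp
      | add x y _ _ hx hy => rw [TensorProduct.tmul_add]; exact add_mem hx hy
      | smul t x _ hx => rw [TensorProduct.tmul_smul]; exact Submodule.smul_mem _ _ hx
      | mem x hx =>
        obtain ⟨a, ha, rfl⟩ := hx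
        induction p using LaurentPolynomial.induction_on' with
        | add p q hp hq => rw [TensorProduct.add_tmul]; exact add_mem hp hq
        | C_mul_T m t =>
          rw [← LaurentPolynomial.smul_eq_C_mul, ← TensorProduct.smul_tmul']
          exact Submodule.smul_mem _ _ (Submodule.subset_span ⟨m, a, ha, rfl⟩)
  · rw [Submodule.span_le]
    rintro _ ⟨m, a, ha, rfl⟩
    exact ⟨LaurentPolynomial.T m ⊗ₜ ⟨X a, Submodule.subset_span ⟨a, ha, rfl⟩⟩, by simp [XL]⟩

theorem XL_mem (m : ℤ) (a : Idx) : XL m a ∈ loopGrading (deg a) := by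
  rw [loopGrading_eq_span]
  exact Submodule.subset_span ⟨m, a, rfl, rfl⟩

theorem mem_loopGrading (m : ℤ) {a : Idx} {d : Z22} (h : deg a = d) : XL m a ∈ loopGrading d :=
  h ▸ XL_mem m a

theorem loopGrading_induction {d : Z22} {p : Loop → Prop} (hX : ∀ m a, deg a = d → p (XL m a))
    (h0 : p 0) (hadd : ∀ x y, p x → p y → p (x + y)) (hsmul : ∀ (t : ℂ) x, p x → p (t • x))
    {x : Loop} (hx : x ∈ loopGrading d) : p x := by
  rw [loopGrading_eq_span] at hx
  induction hx using Submodule.span_induction with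
  | zero => exact h0
  | add x y _ _ hx hy => exact hadd x y hx hy
  | smul t x _ hx => exact hsmul t x hx
  | mem x hx => obtain ⟨m, a, ha, rfl⟩ := hx; exact hX m a ha

/-- The projection of the loop algebra to its component of degree `d`. -/
noncomputable def loopProj (d : Z22) : Loop →ₗ[ℂ] Loop :=
  loopBasis.constr ℂ fun p => if deg p.2 = d then XL p.1 p.2 else 0

theorem loopProj_XL (d : Z22) (m : ℤ) (a : Idx) :
    loopProj d (XL m a) = if deg a = d then XL m a else 0 := by
  rw [← loopBasis_apply, loopProj, Basis.constr_basis, loopBasis_apply]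

theorem isComponentFamily_loopProj : IsComponentFamily loopGrading loopProj where
  mem d x := by
    have : LinearMap.range (loopProj d) ≤ loopGrading d := by
      rw [loopProj, Basis.constr_range, Submodule.span_le]
      rintro _ ⟨p, rfl⟩
      simp only
      split_ifs with h
      · exact mem_loopGrading _ h
      · exact zero_mem _
    exact this ⟨x, rfl⟩
  eq_self d x hx := by
    refine loopGrading_induction (p := fun x => loopProj d x = x) (fun m a h => ?_) (map_zero _)
      (fun x y hx hy => by rw [map_add, hx, hy]) (fun t x hx => by rw [map_smul, hx]) hx
    rw [loopProj_XL, if_pos h]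
  eq_zero d d' x hd hx := by
    refine loopGrading_induction (p := fun x => loopProj d x = 0) (fun m a h => ?_) (map_zero _)
      (fun x y hx hy => by rw [map_add, hx, hy, add_zero])
      (fun t x hx => by rw [map_smul, hx, smul_zero]) hx
    rw [loopProj_XL, if_neg (h ▸ hd.symm)]
  sum_eq x := by
    have : ∑ d, loopProj d = LinearMap.id := loopBasis.ext fun ⟨m, a⟩ => by
      simp [loopBasis_apply, loopProj_XL, LinearMap.sum_apply]
    simpa using LinearMap.congr_fun this x

theorem isInternal_loopGrading : DirectSum.IsInternal loopGrading :=
  isInternal_of_isComponentFamily isComponentFamily_loopProj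

theorem loopBracket_XL_eq (m n : ℤ) (a b : Idx) :
    loopBracket (XL m a) (XL n b) = coef a b • XL (m + n) (tgt a b) := by
  rw [loopBracket_XL]
  simp only [f_eq, Int.cast_ite, Int.cast_zero, ite_smul, zero_smul, Finset.sum_ite_eq',
    Finset.mem_univ, if_true]
  exact Int.cast_smul_eq_zsmul ℂ (coef a b) (XL (m + n) (tgt a b))

section Forms

variable {W : Type*} [AddCommGroup W] [Module ℂ W] {β : Loop →ₗ[ℂ] Loop →ₗ[ℂ] W}

theorem skew_of_basis
    (h : ∀ m a n b, β (XL m a) (XL n b) = -(sgn (deg a) (deg b) • β (XL n b) (XL m a)))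
    (a b : Z22) (x y : Loop) (hx : x ∈ loopGrading a) (hy : y ∈ loopGrading b) :
    β x y = -(sgn a b • β y x) := by
  refine loopGrading_induction (p := fun x => β x y = -(sgn a b • β y x)) (fun m i hi => ?_) (by simp)
    (fun x x' hx hx' => ?_) (fun t x hx => ?_) hx
  · refine loopGrading_induction (p := fun y => β (XL m i) y = -(sgn a b • β y (XL m i)))
      (fun n j hj => ?_) (by simp)
      (fun x x' hx hx' => ?_) (fun t x hx => ?_) hy
    · rw [h, hi, hj]
    · simp only [map_add, LinearMap.add_apply, smul_add, neg_add, hx, hx']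
    · simp only [map_smul, LinearMap.smul_apply, hx, smul_neg, smul_comm t]
  · simp only [map_add, LinearMap.add_apply, smul_add, neg_add, hx, hx']
  · simp only [map_smul, LinearMap.smul_apply, hx, smul_neg, smul_comm t]

theorem jacobi_of_basis
    (h : ∀ m a n b k c, sgn (deg a) (deg c) • β (XL m a) (loopBracket (XL n b) (XL k c))
      + sgn (deg b) (deg a) • β (XL n b) (loopBracket (XL k c) (XL m a))
      + sgn (deg c) (deg b) • β (XL k c) (loopBracket (XL m a) (XL n b)) = 0)
    (a b c : Z22) (x y z : Loop) (hx : x ∈ loopGrading a) (hy : y ∈ loopGrading b)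
    (hz : z ∈ loopGrading c) :
    sgn a c • β x (loopBracket y z) + sgn b a • β y (loopBracket z x)
      + sgn c b • β z (loopBracket x y) = 0 := by
  have key : ∀ p q r p' q' r' : W, p + q + r = 0 → p' + q' + r' = 0 →
      p + p' + (q + q') + (r + r') = 0 := fun p q r p' q' r' e e' => by
    linear_combination (norm := module) e + e'
  let J : Loop → Loop → Loop → Prop := fun x y z =>
    sgn a c • β x (loopBracket y z) + sgn b a • β y (loopBracket z x)
      + sgn c b • β z (loopBracket x y) = 0
  refine loopGrading_induction (p := fun x => J x y z) (fun m i hi => ?_) (by simp [J])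
    (fun x x' hx hx' => ?_) (fun t x hx => ?_) hx
  · refine loopGrading_induction (p := fun y => J (XL m i) y z) (fun n j hj => ?_) (by simp [J])
      (fun x x' hx hx' => ?_) (fun t x hx => ?_) hy
    · refine loopGrading_induction (p := fun z => J (XL m i) (XL n j) z)
        (fun k l hl => ?_) (by simp [J])
        (fun x x' hx hx' => ?_) (fun t x hx => ?_) hz
      · have := h m i n j k l
        rwa [hi, hj, hl] at this
      · simp only [J, map_add, LinearMap.add_apply, smul_add]
        exact key _ _ _ _ _ _ hx hx'
      · simp only [J, map_smul, LinearMap.smul_apply, smul_comm _ t, ← smul_add]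
        rw [hx, smul_zero]
    · simp only [J, map_add, LinearMap.add_apply, smul_add]
      exact key _ _ _ _ _ _ hx hx'
    · simp only [J, map_smul, LinearMap.smul_apply, smul_comm _ t, ← smul_add]
      rw [hx, smul_zero]
  · simp only [J, map_add, LinearMap.add_apply, smul_add]
    exact key _ _ _ _ _ _ hx hx'
  · simp only [J, map_smul, LinearMap.smul_apply, smul_comm _ t, ← smul_add]
    rw [hx, smul_zero]

end Forms

theorem single_smul_sum (c : ℤ) (d : Idx) (n : ℤ) :
    c • XL n d = ∑ e, single c d e • XL n e := by
  simp [single, ite_smul]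

theorem isZ22LieSuperalgebra_loop : IsZ22LieSuperalgebra loopGrading loopBracket where
  isInternal := isInternal_loopGrading
  bracket_mem a b x y hx hy := by
    refine loopGrading_induction (p := fun x => loopBracket x y ∈ loopGrading (a + b))
      (fun m i hi => ?_) (by simp)
      (fun x x' hx hx' => ?_) (fun t x hx => ?_) hx
    · refine loopGrading_induction (p := fun y => loopBracket (XL m i) y ∈ loopGrading (a + b))
        (fun n j hj => ?_) (by simp)
        (fun x x' hx hx' => ?_) (fun t x hx => ?_) hy
      · rw [loopBracket_XL_eq]
        by_cases h : coef i j = 0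
        · simp [h]
        · exact zsmul_mem (mem_loopGrading _ (by rw [deg_tgt i j h, hi, hj])) _
      · rw [map_add]; exact add_mem hx hx'
      · rw [map_smul]; exact Submodule.smul_mem _ _ hx
    · rw [map_add]; exact add_mem hx hx'
    · rw [map_smul]; exact Submodule.smul_mem _ _ hx
  skew := skew_of_basis fun m a n b => by
    rw [loopBracket_XL_eq, loopBracket_XL_eq, coef_skew a b, tgt_comm b a, add_comm n m, smul_smul,
      neg_smul]
  jacobi := jacobi_of_basis fun m a n b k c => by
    simp only [loopBracket_XL_eq, map_zsmul, smul_smul]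
    rw [← add_assoc m n k, show n + (k + m) = m + n + k by ring,
      show k + (m + n) = m + n + k by ring, single_smul_sum, single_smul_sum _ (tgt b _),
      single_smul_sum _ (tgt c _), ← Finset.sum_add_distrib, ← Finset.sum_add_distrib]
    refine Finset.sum_eq_zero fun e _ => ?_
    rw [← add_smul, ← add_smul, ← mul_assoc, ← mul_assoc, ← mul_assoc, jacobi_coef, zero_smul]

/-! ### The affine cocycles -/

set_option maxRecDepth 100000

/-- The matrix of the graded Killing form. -/
def gTable : Idx → Idx → ℤ
  | Lp, Lm | Lm, Lp | Kp, Km | Km, Kp => -6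
  | R, R | S, S => 12
  | ap, am | bp, bm => 24
  | am, ap | bm, bp => -24
  | _, _ => 0

/-- The matrix of the invariant form of degree `(1,1)`. -/
def etaTable : Idx → Idx → ℤ
  | Lp, Km | Lm, Kp | Kp, Lm | Km, Lp => -6
  | R, S | S, R => 12
  | ap, bm | am, bp | bp, am | bm, ap => 24
  | _, _ => 0

theorem g_eq (a b : Idx) : g a b = gTable a b := by
  revert a b; decide +kernel

theorem eta_eq (a b : Idx) : sgn (deg a) (1, 1) * eta a b = etaTable a b := by
  revert a b; decide +kernel

theorem gTable_skew (a b : Idx) : gTable a b = sgn (deg a) (deg b) * gTable b a := by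
  revert a b; decide

theorem etaTable_skew (a b : Idx) : etaTable a b = sgn (deg a) (deg b) * etaTable b a := by
  revert a b; decide

/-- This is the invariance of the Killing form, written so that the three terms of the cocycle
identity have equal tensor factors. -/
theorem gTable_cyclic (a b c : Idx) :
    sgn (deg a) (deg c) * (coef b c * gTable a (tgt b c)) =
      sgn (deg b) (deg a) * (coef c a * gTable b (tgt c a)) := by
  revert a b c; decide +kernel

/-- The sign (-1)^{a·(1,1)} included in `etaTable` is essential here: without it the two sides have
opposite signs for (`R`, `ap`, `bm`). -/
theorem etaTable_cyclic (a b c : Idx) :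
    sgn (deg a) (deg c) * (coef b c * etaTable a (tgt b c)) =
      sgn (deg b) (deg a) * (coef c a * etaTable b (tgt c a)) := by
  revert a b c; decide +kernel

theorem gTable_eq_zero (a b : Idx) (h : deg a ≠ deg b) : gTable a b = 0 := by
  revert a b; decide

theorem etaTable_eq_zero (a b : Idx) (h : deg a + deg b ≠ (1, 1)) : etaTable a b = 0 := by
  revert a b; decide

section Affine

variable {V : Type*} [AddCommGroup V] [Module ℂ V]

theorem affineCocycle_XL_eq (u v : V) (m n : ℤ) (a b : Idx) :
    affineCocycle u v (XL m a) (XL n b) =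
      if m + n = 0 then m • (gTable a b • u + etaTable a b • v) else 0 := by
  rw [affineCocycle_XL, g_eq, eta_eq]

theorem affineCocycle_skew (u v : V) (m n : ℤ) (a b : Idx) :
    affineCocycle u v (XL m a) (XL n b) =
      -(sgn (deg a) (deg b) • affineCocycle u v (XL n b) (XL m a)) := by
  rw [affineCocycle_XL_eq, affineCocycle_XL_eq, add_comm n m]
  split_ifs with h
  · obtain rfl : n = -m := by lia
    rw [gTable_skew a b, etaTable_skew a b]
    module
  · simp

/-- By cyclic invariance the three terms share one value, multiplied by m, n and k respectively; the
sum vanishes because m + n + k = 0 on the support. -/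
theorem affineCocycle_jacobi (u v : V) (m : ℤ) (a : Idx) (n : ℤ) (b : Idx) (k : ℤ) (c : Idx) :
    sgn (deg a) (deg c) • affineCocycle u v (XL m a) (loopBracket (XL n b) (XL k c))
      + sgn (deg b) (deg a) • affineCocycle u v (XL n b) (loopBracket (XL k c) (XL m a))
      + sgn (deg c) (deg b) • affineCocycle u v (XL k c) (loopBracket (XL m a) (XL n b)) = 0 := by
  simp only [loopBracket_XL_eq, map_zsmul, affineCocycle_XL_eq]
  rw [← add_assoc m n k, show n + (k + m) = m + n + k by ring,
    show k + (m + n) = m + n + k by ring]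
  split_ifs with h
  · obtain rfl : k = -m - n := by lia
    have h1 := gTable_cyclic a b c
    have h2 := gTable_cyclic b c a
    have h3 := etaTable_cyclic a b c
    have h4 := etaTable_cyclic b c a
    generalize gTable a _ = x1 at *
    generalize gTable b _ = x2 at *
    generalize gTable c _ = x3 at *
    generalize etaTable a _ = y1 at *
    generalize etaTable b _ = y2 at *
    generalize etaTable c _ = y3 at *
    have e1 := congrArg (fun t : ℤ => t • u) h1
    have e2 := congrArg (fun t : ℤ => t • u) h2
    have e3 := congrArg (fun t : ℤ => t • v) h3
    have e4 := congrArg (fun t : ℤ => t • v) h4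
    linear_combination (norm := module) m • e1 + (m + n) • e2 + m • e3 + (m + n) • e4
  · simp

end Affine

end Osp

/-! ### Cyclic cocycles on the group ring of ℤ × ℤ/2 -/

theorem addMonoidHom_int_prod_zmod_two {V : Type*} [AddCommGroup V] [Module ℂ V]
    (h : ℤ × ZMod 2 →+ V) (p : ℤ × ZMod 2) : h p = p.1 • h (1, 0) := by
  have e : p = p.1 • ((1, 0) : ℤ × ZMod 2) + (0, p.2) := by ext <;> simp
  -- The second factor is torsion, hence it dies in a complex vector space.
  have h2 : (2 : ℂ) • h (0, p.2) = 0 := by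
    rw [two_smul, ← map_add, Prod.mk_add_mk, CharTwo.add_self_eq_zero p.2, add_zero]
    exact map_zero h
  have h0 : h (0, p.2) = 0 := (smul_eq_zero.mp h2).resolve_left two_ne_zero
  conv_lhs => rw [e, map_add, map_zsmul, h0, add_zero]

/-- A cyclic 1-cocycle on the group ring of `ℤ × ℤ/2` is a residue. -/
theorem cyclic_cocycle_eq {V : Type*} [AddCommGroup V] [Module ℂ V]
    {ρ : ℤ × ZMod 2 → ℤ × ZMod 2 → V} (hskew : ∀ p q, ρ p q = -ρ q p)
    (hcyc : ∀ p q r, ρ (p + r) q = ρ p (q + r) + ρ r (p + q)) (p q : ℤ × ZMod 2) :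
    ρ p q = if p.1 + q.1 = 0 then p.1 • ρ (1, 0) (-1, p.2 + q.2) else 0 := by
  -- With the total index p + q fixed, the cyclic identity is exactly additivity in the first
  -- argument.
  let h : ℤ × ZMod 2 →+ V := AddMonoidHom.mk' (fun x => ρ x (p + q - x)) fun x y => by
    have := hcyc x (p + q - (x + y)) y
    rwa [show p + q - (x + y) + y = p + q - x by abel,
      show x + (p + q - (x + y)) = p + q - y by abel] at this
  have hp : ρ p q = h p := by simp [h]
  -- h(p + q) = ρ(p + q, 0) = -ρ(0, p + q) = -h(0). Since h only sees the ℤ-component, this forces h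
  -- = 0 unless that component of p + q is 0.
  have h0 : h (p + q) = 0 := by
    have : h 0 = 0 := map_zero h
    simp only [h, AddMonoidHom.mk'_apply, sub_zero, sub_self] at this ⊢
    rw [hskew, this, neg_zero]
  rw [addMonoidHom_int_prod_zmod_two] at hp h0
  rw [hp]
  split_ifs with hs
  · simp only [h, AddMonoidHom.mk'_apply]
    congr 2
    ext <;> simp [hs]
  · have h0' : ((p.1 + q.1 : ℤ) : ℂ) • h (1, 0) = 0 := by
      rw [Int.cast_smul_eq_zsmul]; exact h0
    rw [(smul_eq_zero.mp h0').resolve_left (by exact_mod_cast hs), smul_zero]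

/-! ### Cocycles in normal form: the even part -/

namespace Osp

open Idx

set_option maxRecDepth 100000

/-- The values on the basis `X^a_m` of a 2-cocycle of the loop algebra. -/
structure IsCocycleFamily {V : Type*} [AddCommGroup V] (W : ℤ → Idx → ℤ → Idx → V) : Prop where
  skew : ∀ m a n b, W m a n b = -(sgn (deg a) (deg b) • W n b m a)
  jacobi : ∀ m a n b k c, (sgn (deg a) (deg c) * coef b c) • W m a (n + k) (tgt b c)
    + (sgn (deg b) (deg a) * coef c a) • W n b (k + m) (tgt c a)
    + (sgn (deg c) (deg b) * coef a b) • W k c (m + n) (tgt a b) = 0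

/-- The vectors `L⁺ θ^i` for `i = 0, 1`, where `θ` turns `x` into `x̃`. -/
def lp (i : ZMod 2) : Idx := if i = 0 then Lp else Kp

/-- The vectors `R θ^i`. -/
def rr (i : ZMod 2) : Idx := if i = 0 then R else S

/-- The vectors `L⁻ θ^i`. -/
def lm (i : ZMod 2) : Idx := if i = 0 then Lm else Km

theorem sgn_rr_rr (i j : ZMod 2) : sgn (deg (rr i)) (deg (rr j)) = 1 := by revert i j; decide

/-- These are the relations of sl₂ ⊗ ℂ[θ]/(θ² - 1): the exponents of θ add in ℤ/2 and no signs
appear. -/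
theorem jacobi_const (i j k : ZMod 2) :
    (sgn (deg (rr i)) (deg (lm k)) * coef (lp j) (lm k) = -1 ∧ tgt (lp j) (lm k) = rr (j + k)) ∧
    (sgn (deg (lp j)) (deg (rr i)) * coef (lm k) (rr i) = 2 ∧ tgt (lm k) (rr i) = lm (k + i)) ∧
    (sgn (deg (lm k)) (deg (lp j)) * coef (rr i) (lp j) = 2 ∧ tgt (rr i) (lp j) = lp (i + j)) ∧
    sgn (deg (lm k)) (deg (lp (i + j))) = 1 := by
  revert i j k; decide

namespace IsCocycleFamily

variable {V : Type*} [AddCommGroup V] {W : ℤ → Idx → ℤ → Idx → V}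

theorem jacobi_eval (hW : IsCocycleFamily W) (m : ℤ) (a : Idx) (n : ℤ) (b : Idx) (k : ℤ) (c : Idx)
    (c₁ : ℤ) (d₁ : Idx) (c₂ : ℤ) (d₂ : Idx) (c₃ : ℤ) (d₃ : Idx)
    (h : (sgn (deg a) (deg c) * coef b c = c₁ ∧ tgt b c = d₁) ∧
      (sgn (deg b) (deg a) * coef c a = c₂ ∧ tgt c a = d₂) ∧
      (sgn (deg c) (deg b) * coef a b = c₃ ∧ tgt a b = d₃)) :
    c₁ • W m a (n + k) d₁ + c₂ • W n b (k + m) d₂ + c₃ • W k c (m + n) d₃ = 0 := by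
  obtain ⟨⟨rfl, rfl⟩, ⟨rfl, rfl⟩, ⟨rfl, rfl⟩⟩ := h
  exact hW.jacobi m a n b k c

variable [Module ℂ V]

/-- The Jacobi identity with the zero mode of `R` multiplies W by the total weight; the remaining
term pairs R_0 with a vector of that same nonzero weight, and is zero by `hR`. -/
theorem eq_zero_of_wt (hW : IsCocycleFamily W) (hR : ∀ m c, wt c ≠ 0 → W 0 R m c = 0)
    {a b : Idx} (m n : ℤ) (h : wt a + wt b ≠ 0) : W m a n b = 0 := by
  have h1 : coef a b • W 0 R (m + n) (tgt a b) = 0 := by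
    by_cases h0 : coef a b = 0
    · rw [h0, zero_smul]
    · rw [hR _ _ (by rwa [wt_tgt a b h0]), smul_zero]
  have hJ := hW.jacobi 0 R m a n b
  have s1 : sgn (deg R) (deg b) = 1 := by clear * -; revert b; decide
  have s2 : sgn (deg a) (deg R) = 1 := by clear * -; revert a; decide
  have s3 : coef b R = -wt b := by rw [coef_skew, coef_R, sgn_comm, s1, one_mul]
  rw [s1, s2, s3, tgt_comm b R, tgt_R, tgt_R, coef_R, one_mul, h1, add_zero, zero_add m,
    hW.skew n b m a, zero_add, one_mul, mul_comm, smul_neg, smul_smul] at hJ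
  have s4 : sgn (deg b) (deg a) * sgn (deg b) (deg a) = 1 := by clear * -; revert a b; decide
  rw [mul_assoc, s4, mul_one] at hJ
  have : ((wt a + wt b : ℤ) : ℂ) • W m a n b = 0 := by
    linear_combination (norm := module) -hJ
  exact (smul_eq_zero.mp this).resolve_left (by exact_mod_cast h)

end IsCocycleFamily

/-- A cocycle family in the normal form that coboundaries allow. -/
structure IsNormalized {V : Type*} [AddCommGroup V] (W : ℤ → Idx → ℤ → Idx → V) : Prop extends IsCocycleFamily W where
  R_left : ∀ m c, wt c ≠ 0 → W 0 R m c = 0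
  lp_Lm : ∀ m i, W m (lp i) 0 Lm = 0

namespace IsNormalized

open IsCocycleFamily

variable {V : Type*} [AddCommGroup V] {W : ℤ → Idx → ℤ → Idx → V}

theorem rr_skew (hW : IsNormalized W) (p q : ℤ × ZMod 2) :
    W p.1 (rr p.2) q.1 (rr q.2) = -W q.1 (rr q.2) p.1 (rr p.2) := by
  rw [hW.skew, sgn_rr_rr, one_smul]

theorem rr_lp_lm (hW : IsNormalized W) (p q r : ℤ × ZMod 2) :
    W p.1 (rr p.2) (q + r).1 (rr (q + r).2) = (2 : ℤ) • W q.1 (lp q.2) (r + p).1 (lm (r + p).2)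
      - (2 : ℤ) • W (p + q).1 (lp (p + q).2) r.1 (lm r.2) := by
  obtain ⟨h1, h2, h3, h4⟩ := jacobi_const p.2 q.2 r.2
  have := hW.jacobi_eval p.1 (rr p.2) q.1 (lp q.2) r.1 (lm r.2) _ _ _ _ _ _ ⟨h1, h2, h3⟩
  rw [hW.skew r.1 (lm r.2), h4] at this
  simp only [Prod.fst_add, Prod.snd_add]
  linear_combination (norm := module) -this

/-- In `rr_lp_lm` take r = 0: the last term is one of the values that the normalization kills. -/
theorem two_smul_lp_lm (hW : IsNormalized W) (p q : ℤ × ZMod 2) :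
    (2 : ℤ) • W q.1 (lp q.2) p.1 (lm p.2) = W p.1 (rr p.2) q.1 (rr q.2) := by
  have := hW.rr_lp_lm p q 0
  have h0 : W (p + q).1 (lp (p + q).2) (0 : ℤ × ZMod 2).1 (lm (0 : ℤ × ZMod 2).2) = 0 :=
    hW.lp_Lm _ _
  rw [h0, add_zero, zero_add, smul_zero, sub_zero] at this
  exact this.symm

/-- Eliminating the (L⁺, L⁻) values from `rr_lp_lm` leaves a condition on the R-values alone. -/
theorem rr_cyclic (hW : IsNormalized W) (p q r : ℤ × ZMod 2) :
    W (p + r).1 (rr (p + r).2) q.1 (rr q.2) =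
      W p.1 (rr p.2) (q + r).1 (rr (q + r).2) + W r.1 (rr r.2) (p + q).1 (rr (p + q).2) := by
  rw [hW.rr_lp_lm p q r, hW.two_smul_lp_lm, hW.two_smul_lp_lm, add_comm r p, sub_add_cancel]

variable [Module ℂ V]

theorem rr_eq (hW : IsNormalized W) (m n : ℤ) (i j : ZMod 2) :
    W m (rr i) n (rr j) = if m + n = 0 then m • W 1 R (-1) (rr (i + j)) else 0 :=
  cyclic_cocycle_eq (ρ := fun p q => W p.1 (rr p.2) q.1 (rr q.2)) hW.rr_skew hW.rr_cyclic
    (m, i) (n, j)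

theorem lp_lm_eq (hW : IsNormalized W) (m n : ℤ) (i j : ZMod 2) :
    (2 : ℤ) • W m (lp i) n (lm j) = if m + n = 0 then -m • W 1 R (-1) (rr (i + j)) else 0 := by
  rw [hW.two_smul_lp_lm (n, j) (m, i), hW.rr_eq, add_comm n m, add_comm j i]
  split_ifs with h
  · rw [show n = -m by lia]
  · rfl

theorem rr_zero_left (hW : IsNormalized W) (n : ℤ) (i j : ZMod 2) :
    W 0 (rr i) n (rr j) = 0 := by
  rw [hW.rr_eq, zero_smul, ite_self]

theorem lp_zero_left (hW : IsNormalized W) (n : ℤ) (i j : ZMod 2) :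
    W 0 (lp i) n (lm j) = 0 := by
  have h := hW.lp_lm_eq 0 n i j
  rw [neg_zero, zero_smul, ite_self, ← Int.cast_smul_eq_zsmul ℂ] at h
  exact (smul_eq_zero.mp h).resolve_left (by norm_num)

/-! ### Cocycles in normal form: the odd part -/

theorem bp_bm (hW : IsNormalized W) (m n : ℤ) : W m bp n bm = W m ap n am := by
  -- The zero mode of S exchanges a^± with ã^±, and its own pairing with ⟦a⁺, ã⁻⟧, a multiple of S,
  -- vanishes by `rr_zero_left`.
  have h := hW.jacobi_eval 0 S m ap n bm (-2) S (-1) am 1 bp (by decide)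
  have h0 : W 0 S (m + n) S = 0 := hW.rr_zero_left _ 1 1
  have hs := hW.skew m bp n bm
  rw [show sgn (deg bp) (deg bm) = -1 by decide] at hs
  rw [h0, add_zero, zero_add] at h
  linear_combination (norm := module) h + hs

theorem am_bp (hW : IsNormalized W) (m n : ℤ) : W m am n bp = -W n ap m bm := by
  have h := hW.jacobi_eval 0 S n ap m am (-2) R (-1) bm (-1) bp (by decide)
  have h0 : W 0 S (n + m) R = 0 := hW.rr_zero_left _ 1 0
  rw [h0, add_zero, zero_add] at h
  linear_combination (norm := module) -h

theorem bp_am (hW : IsNormalized W) (m n : ℤ) : W m bp n am = W m ap n bm := by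
  rw [hW.skew, hW.am_bp, show sgn (deg bp) (deg am) = 1 by decide, one_smul, neg_neg]

/-- The zero mode of L⁺ sends either a⁻ in the pair (a⁻_m, a⁻_n) to -a⁺, which relates the two
distributions of the modes. -/
theorem ap_am_swap (hW : IsNormalized W) (m n : ℤ) : W m ap n am = -W n ap m am := by
  have h := hW.jacobi_eval 0 Lp m am n am 4 Lm 1 ap 1 ap (by decide)
  have h0 : W 0 Lp (m + n) Lm = 0 := hW.lp_zero_left _ 0 0
  have h1 := hW.skew m am n ap
  have h2 := hW.skew n am m ap
  rw [show sgn (deg am) (deg ap) = -1 by decide] at h1 h2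
  rw [h0, add_zero, zero_add] at h
  linear_combination (norm := module) h - h1 - h2

theorem ap_bm_swap (hW : IsNormalized W) (m n : ℤ) : W m ap n bm = -W n ap m bm := by
  have h := hW.jacobi_eval 0 Lp m am n bm 4 Km (-1) bp (-1) ap (by decide)
  have h0 : W 0 Lp (m + n) Km = 0 := hW.lp_zero_left _ 0 1
  have h2 := hW.skew n bm m ap
  rw [show sgn (deg bm) (deg ap) = 1 by decide] at h2
  rw [h0, add_zero, zero_add, hW.am_bp] at h
  linear_combination (norm := module) h + h2

/-- Taking q = r = 0 shows that P(n, 0) is symmetric as well as antisymmetric, hence 0; then r = 0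
expresses P through ρ. -/
theorem odd_eq {P ρ : ℤ → ℤ → V} (hs : ∀ m n, P m n = -P n m) (h0 : ∀ m, ρ m 0 = 0)
    (h : ∀ p q r, (2 : ℤ) • ρ p (q + r) + P q (r + p) - P (p + q) r = 0) (m n : ℤ) :
    P m n = (2 : ℤ) • ρ m n := by
  have h2 : ∀ n, P n 0 = 0 := fun n => by
    have e := h n 0 0
    simp only [add_zero, zero_add, h0, smul_zero] at e
    have e' := hs 0 n
    have : (2 : ℂ) • P n 0 = 0 := by linear_combination (norm := module) e' - e
    exact (smul_eq_zero.mp this).resolve_left two_ne_zero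
  have e := h m n 0
  rw [add_zero, zero_add, h2] at e
  have e' := hs m n
  linear_combination (norm := module) e' - e

theorem ap_am (hW : IsNormalized W) (m n : ℤ) : W m ap n am = (2 : ℤ) • W m R n R := by
  refine odd_eq (P := fun m n => W m ap n am) (ρ := fun m n => W m R n R) hW.ap_am_swap
    (fun m => ?_) (fun p q r => ?_) m n
  · refine (hW.rr_skew (m, 0) (0, 0)).trans ?_
    rw [hW.rr_zero_left, neg_zero]
  · have h := hW.jacobi_eval p R q ap r am 2 R 1 am (-1) ap (by decide)
    have h1 := hW.skew r am (p + q) ap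
    rw [show sgn (deg am) (deg ap) = -1 by decide] at h1
    linear_combination (norm := module) h + h1

theorem ap_bm (hW : IsNormalized W) (m n : ℤ) : W m ap n bm = (2 : ℤ) • W m R n S := by
  refine odd_eq (P := fun m n => W m ap n bm) (ρ := fun m n => W m R n S) hW.ap_bm_swap
    (fun m => ?_) (fun p q r => ?_) m n
  · refine (hW.rr_skew (m, 0) (0, 1)).trans ?_
    rw [hW.rr_zero_left, neg_zero]
  · have h := hW.jacobi_eval p R q ap r bm 2 S 1 bm 1 ap (by decide)
    have h1 := hW.skew r bm (p + q) ap
    rw [show sgn (deg bm) (deg ap) = 1 by decide] at h1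
    linear_combination (norm := module) h - h1

/-- The value of the affine cocycle on `(X^a_m, X^b_n)`. -/
def affineValue (u v : V) (m : ℤ) (a : Idx) (n : ℤ) (b : Idx) : V :=
  if m + n = 0 then m • (gTable a b • u + etaTable a b • v) else 0

theorem eq_affineValue (hW : IsNormalized W) (m n : ℤ) (a b : Idx) :
    W m a n b = affineValue ((12⁻¹ : ℂ) • W 1 R (-1) R) ((12⁻¹ : ℂ) • W 1 R (-1) S) m a n b := by
  -- 12 is the entry of `gTable` at (R, R) and of `etaTable` at (R, S).
  set u := (12⁻¹ : ℂ) • W 1 R (-1) R with hu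
  set v := (12⁻¹ : ℂ) • W 1 R (-1) S with hv
  have hu' : W 1 R (-1) R = (12 : ℂ) • u := by rw [hu, smul_smul]; norm_num
  have hv' : W 1 R (-1) S = (12 : ℂ) • v := by rw [hv, smul_smul]; norm_num
  by_cases hwt : wt a + wt b = 0
  swap
  · have hg : gTable a b = 0 ∧ etaTable a b = 0 := by
      clear * - hwt; revert a b; decide
    rw [hW.eq_zero_of_wt hW.R_left m n hwt, affineValue, hg.1, hg.2]
    simp
  let H : Idx → Idx → Prop := fun a b => ∀ m n, W m a n b = affineValue u v m a n b
  have swap : ∀ {a b}, H a b → H b a := fun {a b} h m n => by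
    have := affineCocycle_skew u v m n b a
    simp only [affineCocycle_XL_eq] at this
    rw [hW.skew, h]
    exact this.symm
  have hRR : ∀ m n, W m R n R = if m + n = 0 then m • (12 : ℂ) • u else 0 :=
    hu' ▸ fun m n => hW.rr_eq m n 0 0
  have hRS : ∀ m n, W m R n S = if m + n = 0 then m • (12 : ℂ) • v else 0 :=
    hv' ▸ fun m n => hW.rr_eq m n 0 1
  have hSS : ∀ m n, W m S n S = if m + n = 0 then m • (12 : ℂ) • u else 0 :=
    hu' ▸ fun m n => hW.rr_eq m n 1 1
  have lift : ∀ {a b} (x y : ℤ), gTable a b = x ∧ etaTable a b = y →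
      (∀ m n, W m a n b = if m + n = 0 then m • (x • u + y • v) else 0) → H a b := by
    rintro a b _ _ ⟨rfl, rfl⟩ h
    exact h
  have hl : ∀ {a b} (x y : ℤ), gTable a b = x ∧ etaTable a b = y →
      (∀ m n, (2 : ℤ) • W m a n b = if m + n = 0 then m • ((2 * x) • u + (2 * y) • v) else 0) →
      H a b := by
    intro a b x y hxy h
    refine lift x y hxy fun m n => ?_
    have h := h m n
    split_ifs at h ⊢ <;> linear_combination (norm := module) (2⁻¹ : ℂ) • h
  have h1 : H Lp Lm := hl (-6) 0 (by decide) fun m n => by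
    refine (hW.lp_lm_eq m n 0 0).trans ?_
    change (if _ then -m • W 1 R (-1) R else 0) = _
    rw [hu']
    split_ifs <;> module
  have h2 : H Lp Km := hl 0 (-6) (by decide) fun m n => by
    refine (hW.lp_lm_eq m n 0 1).trans ?_
    change (if _ then -m • W 1 R (-1) S else 0) = _
    rw [hv']
    split_ifs <;> module
  have h3 : H Kp Lm := hl 0 (-6) (by decide) fun m n => by
    refine (hW.lp_lm_eq m n 1 0).trans ?_
    change (if _ then -m • W 1 R (-1) S else 0) = _
    rw [hv']
    split_ifs <;> module
  have h4 : H Kp Km := hl (-6) 0 (by decide) fun m n => by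
    refine (hW.lp_lm_eq m n 1 1).trans ?_
    change (if _ then -m • W 1 R (-1) R else 0) = _
    rw [hu']
    split_ifs <;> module
  have h5 : H R R := lift 12 0 (by decide) fun m n => by
    rw [hRR]
    split_ifs <;> module
  have h6 : H R S := lift 0 12 (by decide) fun m n => by
    rw [hRS]
    split_ifs <;> module
  have h7 : H S S := lift 12 0 (by decide) fun m n => by
    rw [hSS]
    split_ifs <;> module
  have h8 : H ap am := lift 24 0 (by decide) fun m n => by
    rw [hW.ap_am, hRR]
    split_ifs <;> module
  have h9 : H ap bm := lift 0 24 (by decide) fun m n => by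
    rw [hW.ap_bm, hRS]
    split_ifs <;> module
  have h10 : H bp bm := fun m n => (hW.bp_bm m n).trans (h8 m n)
  have h11 : H bp am := fun m n => (hW.bp_am m n).trans (h9 m n)
  suffices H a b from this m n
  -- Up to order, the eleven pairs above are all the pairs of total weight 0.
  cases a <;> cases b <;> first
    | exact absurd hwt (by decide)
    | assumption
    | exact swap (by assumption)

end IsNormalized
-- Cocycles of the loop algebra modulo coboundaries
section Classification

variable {V : Type*} [AddCommGroup V] [Module ℂ V]

/-- The 2-cocycles of the loop algebra with values in a vector space. -/
structure IsCocycle (ω : Loop →ₗ[ℂ] Loop →ₗ[ℂ] V) : Prop where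
  skew : ∀ (a b : Z22) (x y : Loop), x ∈ loopGrading a → y ∈ loopGrading b →
    ω x y = -(sgn a b • ω y x)
  jacobi : ∀ (a b c : Z22) (x y z : Loop), x ∈ loopGrading a → y ∈ loopGrading b →
    z ∈ loopGrading c →
    sgn a c • ω x (loopBracket y z) + sgn b a • ω y (loopBracket z x)
      + sgn c b • ω z (loopBracket x y) = 0

theorem isCocycle_affineCocycle (u v : V) : IsCocycle (affineCocycle u v) where
  skew := skew_of_basis fun m a n b => affineCocycle_skew u v m n a b
  jacobi := jacobi_of_basis (affineCocycle_jacobi u v)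

theorem isCocycle_coboundary (f : Loop →ₗ[ℂ] V) : IsCocycle (loopBracket.compr₂ f) where
  skew a b x y hx hy := by
    simp only [LinearMap.compr₂_apply, isZ22LieSuperalgebra_loop.skew a b x y hx hy, map_neg,
      map_zsmul]
  jacobi a b c x y z hx hy hz := by
    simpa only [LinearMap.compr₂_apply, map_add, map_zsmul, map_zero] using
      congrArg f (isZ22LieSuperalgebra_loop.jacobi a b c x y z hx hy hz)

theorem IsCocycle.sub {ω ω' : Loop →ₗ[ℂ] Loop →ₗ[ℂ] V} (h : IsCocycle ω) (h' : IsCocycle ω') :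
    IsCocycle (ω - ω') where
  skew a b x y hx hy := by
    simp only [LinearMap.sub_apply, smul_sub, neg_sub', h.skew a b x y hx hy,
      h'.skew a b x y hx hy]
  jacobi a b c x y z hx hy hz := by
    simp only [LinearMap.sub_apply, smul_sub]
    linear_combination (norm := module) h.jacobi a b c x y z hx hy hz -
      h'.jacobi a b c x y z hx hy hz

theorem IsCocycle.isCocycleFamily {ω : Loop →ₗ[ℂ] Loop →ₗ[ℂ] V} (h : IsCocycle ω) :
    IsCocycleFamily fun m a n b => ω (XL m a) (XL n b) where
  skew m a n b := h.skew _ _ _ _ (XL_mem m a) (XL_mem n b)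
  jacobi m a n b k c := by
    have := h.jacobi _ _ _ _ _ _ (XL_mem m a) (XL_mem n b) (XL_mem k c)
    simpa only [loopBracket_XL_eq, map_zsmul, smul_smul] using this

/-- The values on the basis of the linear form that normalizes a cocycle. -/
noncomputable def potentialValue (ω : Loop →ₗ[ℂ] Loop →ₗ[ℂ] V) (m : ℤ) (c : Idx) : V :=
  if wt c = 0 then -ω (XL m (if c = R then Lp else Kp)) (XL 0 Lm)
  else (wt c : ℂ)⁻¹ • ω (XL 0 R) (XL m c)

/-- The linear form that normalizes a cocycle. -/
noncomputable def potential (ω : Loop →ₗ[ℂ] Loop →ₗ[ℂ] V) : Loop →ₗ[ℂ] V :=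
  loopBasis.constr ℂ fun p => potentialValue ω p.1 p.2

theorem potential_XL (ω : Loop →ₗ[ℂ] Loop →ₗ[ℂ] V) (m : ℤ) (c : Idx) :
    potential ω (XL m c) = potentialValue ω m c := by
  rw [← loopBasis_apply, potential, Basis.constr_basis]

/-- Since ⟦R_0, X^c_m⟧ = wt(c) X^c_m, the potential on nonzero weights is fixed by dividing by
wt(c). On R_m and S_m it is fixed by ⟦L⁺_m, L⁻_0⟧ = -R_m and ⟦L̃⁺_m, L⁻_0⟧ = -S_m. -/
theorem isNormalized_sub_potential {ω : Loop →ₗ[ℂ] Loop →ₗ[ℂ] V} (h : IsCocycle ω) :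
    IsNormalized fun m a n b => (ω - loopBracket.compr₂ (potential ω)) (XL m a) (XL n b) where
  toIsCocycleFamily := (h.sub (isCocycle_coboundary _)).isCocycleFamily
  R_left m c hc := by
    have hc' : (wt c : ℂ) ≠ 0 := by exact_mod_cast hc
    rw [LinearMap.sub_apply, LinearMap.sub_apply, LinearMap.compr₂_apply, loopBracket_XL_eq,
      coef_R, tgt_R, map_zsmul, potential_XL, potentialValue, if_neg hc, zero_add,
      ← Int.cast_smul_eq_zsmul ℂ, smul_inv_smul₀ hc', sub_self]
  lp_Lm m i := by
    have h1 : coef (lp i) Lm = -1 ∧ tgt (lp i) Lm = rr i ∧ wt (rr i) = 0 ∧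
        (if rr i = R then Lp else Kp) = lp i := by
      clear * -; revert i; decide
    obtain ⟨h1, h2, h3, h4⟩ := h1
    rw [LinearMap.sub_apply, LinearMap.sub_apply, LinearMap.compr₂_apply, loopBracket_XL_eq,
      h1, h2, map_zsmul, potential_XL, potentialValue, if_pos h3, h4, add_zero, neg_smul, one_smul,
      neg_neg, sub_self]

theorem loopBracket_R_R (m n : ℤ) : loopBracket (XL m R) (XL n R) = 0 := by
  rw [loopBracket_XL_eq, show coef R R = 0 by decide, zero_smul]

theorem loopBracket_R_S (m n : ℤ) : loopBracket (XL m R) (XL n S) = 0 := by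
  rw [loopBracket_XL_eq, show coef R S = 0 by decide, zero_smul]

/-- The parameters can be read off ω itself, because the subtracted coboundary vanishes on the
commuting pairs (R_1, R_{-1}) and (R_1, S_{-1}). -/
theorem IsCocycle.eq_affineCocycle_add {ω : Loop →ₗ[ℂ] Loop →ₗ[ℂ] V} (h : IsCocycle ω) :
    ω = affineCocycle ((12⁻¹ : ℂ) • ω (XL 1 R) (XL (-1) R)) ((12⁻¹ : ℂ) • ω (XL 1 R) (XL (-1) S))
      + loopBracket.compr₂ (potential ω) := by
  rw [← sub_eq_iff_eq_add]
  refine loopBasis.ext fun ⟨m, a⟩ => loopBasis.ext fun ⟨n, b⟩ => ?_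
  rw [loopBasis_apply, loopBasis_apply, affineCocycle_XL_eq]
  have := (isNormalized_sub_potential h).eq_affineValue m n a b
  simpa only [LinearMap.sub_apply, LinearMap.compr₂_apply, loopBracket_R_R, loopBracket_R_S,
    map_zero, sub_zero, IsNormalized.affineValue] using this

theorem affineCocycle_R_R (u v : V) :
    affineCocycle u v (XL 1 R) (XL (-1) R) = (12 : ℂ) • u := by
  rw [affineCocycle_XL_eq, if_pos (by norm_num), gTable, etaTable]
  · module
  all_goals simp

theorem affineCocycle_R_S (u v : V) :
    affineCocycle u v (XL 1 R) (XL (-1) S) = (12 : ℂ) • v := by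
  rw [affineCocycle_XL_eq, if_pos (by norm_num), show gTable R S = 0 by decide,
    show etaTable R S = 12 by decide]
  module

/-- Cohomologous affine cocycles are equal. -/
theorem affineCocycle_injective {u v u' v' : V} {f : Loop →ₗ[ℂ] V}
    (h : ∀ x y, affineCocycle u v x y = affineCocycle u' v' x y + f (loopBracket x y)) :
    u = u' ∧ v = v' := by
  -- Commuting pairs, on which the term with f disappears.
  have h1 := h (XL 1 R) (XL (-1) R)
  have h2 := h (XL 1 R) (XL (-1) S)
  rw [affineCocycle_R_R, affineCocycle_R_R, loopBracket_R_R, map_zero, add_zero] at h1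
  rw [affineCocycle_R_S, affineCocycle_R_S, loopBracket_R_S, map_zero, add_zero] at h2
  exact ⟨smul_right_injective V (by norm_num : (12 : ℂ) ≠ 0) h1,
    smul_right_injective V (by norm_num : (12 : ℂ) ≠ 0) h2⟩

variable {𝒱 : Z22 → Submodule ℂ V}

theorem affineCocycle_mem {u v : V} (hu : u ∈ 𝒱 (0, 0)) (hv : v ∈ 𝒱 (1, 1)) (a b : Z22)
    (x y : Loop) (hx : x ∈ loopGrading a) (hy : y ∈ loopGrading b) :
    affineCocycle u v x y ∈ 𝒱 (a + b) := by
  refine loopGrading_induction (p := fun x => affineCocycle u v x y ∈ 𝒱 (a + b))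
    (fun m i hi => ?_) (by simp) (fun x x' hx hx' => ?_) (fun t x hx => ?_) hx
  · refine loopGrading_induction (p := fun y => affineCocycle u v (XL m i) y ∈ 𝒱 (a + b))
      (fun n j hj => ?_) (by simp) (fun x x' hx hx' => ?_) (fun t x hx => ?_) hy
    · rw [affineCocycle_XL_eq]
      have hg : gTable i j • u ∈ 𝒱 (a + b) := by
        by_cases h : deg i = deg j
        · rw [← hi, ← hj, h, show deg j + deg j = (0, 0) by clear * -; revert j; decide]
          exact zsmul_mem hu _
        · rw [gTable_eq_zero i j h, zero_smul]
          exact zero_mem _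
      have he : etaTable i j • v ∈ 𝒱 (a + b) := by
        by_cases h : deg i + deg j = (1, 1)
        · rw [← hi, ← hj, h]
          exact zsmul_mem hv _
        · rw [etaTable_eq_zero i j h, zero_smul]
          exact zero_mem _
      split_ifs
      · exact zsmul_mem (add_mem hg he) _
      · exact zero_mem _
    · rw [map_add]; exact add_mem hx hx'
    · rw [map_smul]; exact Submodule.smul_mem _ _ hx
  · rw [map_add]; exact add_mem hx hx'
  · rw [map_smul]; exact Submodule.smul_mem _ _ hx

/-- The potential is graded because it pairs with R_0 or L⁻_0, both of degree (0,0). This is what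
makes the resulting equivalence of extensions degree-preserving. -/
theorem potential_mem {ω : Loop →ₗ[ℂ] Loop →ₗ[ℂ] V}
    (h : ∀ a b x y, x ∈ loopGrading a → y ∈ loopGrading b → ω x y ∈ 𝒱 (a + b)) {d : Z22}
    {x : Loop} (hx : x ∈ loopGrading d) : potential ω x ∈ 𝒱 d := by
  refine loopGrading_induction (p := fun x => potential ω x ∈ 𝒱 d)
    (fun m c hc => ?_) (by simp) (fun x x' hx hx' => ?_) (fun t x hx => ?_) hx
  · rw [potential_XL, potentialValue, ← hc]
    split_ifs with h0 h1
    · subst h1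
      exact neg_mem (h _ _ _ _ (XL_mem m Lp) (XL_mem 0 Lm))
    · have := h _ _ _ _ (XL_mem m Kp) (XL_mem 0 Lm)
      rw [show deg Kp + deg Lm = deg c by clear * - h0 h1; revert c; decide] at this
      exact neg_mem this
    · have := h _ _ _ _ (XL_mem 0 R) (XL_mem m c)
      rw [show deg R + deg c = deg c by clear * -; revert c; decide] at this
      exact Submodule.smul_mem _ _ this
  · rw [map_add]; exact add_mem hx hx'
  · rw [map_smul]; exact Submodule.smul_mem _ _ hx

end Classification

end Osp

/-! ### Graded central extensions and their cocycles -/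

namespace IsGradedCentralExtension

variable {L V E : Type*} [AddCommGroup L] [Module ℂ L] [AddCommGroup V] [Module ℂ V]
  [AddCommGroup E] [Module ℂ E]
  {𝓛 : Z22 → Submodule ℂ L} {brL : L →ₗ[ℂ] L →ₗ[ℂ] L} {𝒱 : Z22 → Submodule ℂ V}
  {ℰ : Z22 → Submodule ℂ E} {brE : E →ₗ[ℂ] E →ₗ[ℂ] E} {ι : V →ₗ[ℂ] E} {π : E →ₗ[ℂ] L}

theorem π_ι (h : IsGradedCentralExtension 𝓛 brL 𝒱 ℰ brE ι π) (v : V) : π (ι v) = 0 := by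
  have : ι v ∈ LinearMap.ker π := h.exact ▸ LinearMap.mem_range_self ι v
  exact this

/-- A degree-preserving map commutes with the component projections, so an injective one also
reflects degrees. -/
theorem mem_of_ι_mem (h : IsGradedCentralExtension 𝓛 brL 𝒱 ℰ brE ι π)
    (hV : DirectSum.IsInternal 𝒱) {d : Z22} {v : V} (hv : ι v ∈ ℰ d) : v ∈ 𝒱 d := by
  obtain ⟨P, hP⟩ := exists_isComponentFamily hV
  obtain ⟨Q, hQ⟩ := exists_isComponentFamily h.lie.isInternal
  have := hP.map_apply hQ h.ι_mem d v
  rw [hQ.eq_self d _ hv] at this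
  rw [h.injective this]
  exact hP.mem d v

/-- The component of degree d of any preimage is still a preimage, since π commutes with the
projections. -/
theorem exists_lift (h : IsGradedCentralExtension 𝓛 brL 𝒱 ℰ brE ι π)
    (hL : DirectSum.IsInternal 𝓛) {d : Z22} {x : L} (hx : x ∈ 𝓛 d) : ∃ e ∈ ℰ d, π e = x := by
  obtain ⟨P, hP⟩ := exists_isComponentFamily hL
  obtain ⟨Q, hQ⟩ := exists_isComponentFamily h.lie.isInternal
  obtain ⟨e, rfl⟩ := h.surjective x
  exact ⟨Q d e, hQ.mem d e, by rw [← hQ.map_apply hP h.π_mem, hP.eq_self d _ hx]⟩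

/-- Centrality is assumed on the right only. Graded antisymmetry transfers it to homogeneous
components on the left, and then to all elements. -/
theorem central_left (h : IsGradedCentralExtension 𝓛 brL 𝒱 ℰ brE ι π)
    (hV : DirectSum.IsInternal 𝒱) (v : V) (e : E) : brE (ι v) e = 0 := by
  obtain ⟨P, hP⟩ := exists_isComponentFamily hV
  obtain ⟨Q, hQ⟩ := exists_isComponentFamily h.lie.isInternal
  rw [← hP.sum_eq v, ← hQ.sum_eq e]
  simp only [map_sum, LinearMap.sum_apply]
  refine Finset.sum_eq_zero fun d _ => Finset.sum_eq_zero fun d' _ => ?_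
  rw [h.lie.skew _ _ _ _ (h.ι_mem _ _ (hP.mem _ v)) (hQ.mem _ e), h.central, smul_zero, neg_zero]

variable {s : L →ₗ[ℂ] E} {ω : L →ₗ[ℂ] L →ₗ[ℂ] V}

/-- The cocycle of a linear section. -/
theorem exists_cocycle (h : IsGradedCentralExtension 𝓛 brL 𝒱 ℰ brE ι π)
    (hs : ∀ x, π (s x) = x) :
    ∃ ω : L →ₗ[ℂ] L →ₗ[ℂ] V, ∀ x y, brE (s x) (s y) = s (brL x y) + ι (ω x y) := by
  -- A linear left inverse of ι makes the V-valued defect of s bilinear by construction.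
  obtain ⟨j, hj⟩ := LinearMap.exists_leftInverse_of_injective ι
    (LinearMap.ker_eq_bot.mpr h.injective)
  refine ⟨(brE.compl₁₂ s s - brL.compr₂ s).compr₂ j, fun x y => ?_⟩
  have : brE (s x) (s y) - s (brL x y) ∈ LinearMap.range ι := by
    rw [h.exact, LinearMap.mem_ker, map_sub, h.map_bracket, hs, hs, hs, sub_self]
  obtain ⟨v, hv⟩ := this
  have hjv : j (ι v) = v := LinearMap.congr_fun hj v
  rw [LinearMap.compr₂_apply, LinearMap.sub_apply, LinearMap.sub_apply, LinearMap.compl₁₂_apply,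
    LinearMap.compr₂_apply, ← hv, hjv, hv, add_sub_cancel]

theorem cocycle_skew (h : IsGradedCentralExtension 𝓛 brL 𝒱 ℰ brE ι π)
    (hL : IsZ22LieSuperalgebra 𝓛 brL) (hs : ∀ d x, x ∈ 𝓛 d → s x ∈ ℰ d)
    (hω : ∀ x y, brE (s x) (s y) = s (brL x y) + ι (ω x y)) (a b : Z22) (x y : L)
    (hx : x ∈ 𝓛 a) (hy : y ∈ 𝓛 b) : ω x y = -(sgn a b • ω y x) := by
  apply h.injective
  have h1 := h.lie.skew a b _ _ (hs _ _ hx) (hs _ _ hy)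
  rw [hω, hω, hL.skew a b x y hx hy, map_neg, map_zsmul] at h1
  rw [map_neg, map_zsmul]
  linear_combination (norm := module) h1

theorem cocycle_jacobi (h : IsGradedCentralExtension 𝓛 brL 𝒱 ℰ brE ι π)
    (hL : IsZ22LieSuperalgebra 𝓛 brL) (hs : ∀ d x, x ∈ 𝓛 d → s x ∈ ℰ d)
    (hω : ∀ x y, brE (s x) (s y) = s (brL x y) + ι (ω x y)) (a b c : Z22) (x y z : L)
    (hx : x ∈ 𝓛 a) (hy : y ∈ 𝓛 b) (hz : z ∈ 𝓛 c) :
    sgn a c • ω x (brL y z) + sgn b a • ω y (brL z x) + sgn c b • ω z (brL x y) = 0 := by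
  apply h.injective
  have h1 := h.lie.jacobi a b c _ _ _ (hs _ _ hx) (hs _ _ hy) (hs _ _ hz)
  have h2 := congrArg s (hL.jacobi a b c x y z hx hy hz)
  simp only [hω, map_add, h.central, add_zero, map_zsmul, map_zero] at h1 h2 ⊢
  linear_combination (norm := module) h1 - h2

theorem cocycle_mem (h : IsGradedCentralExtension 𝓛 brL 𝒱 ℰ brE ι π)
    (hV : DirectSum.IsInternal 𝒱) (hL : IsZ22LieSuperalgebra 𝓛 brL)
    (hs : ∀ d x, x ∈ 𝓛 d → s x ∈ ℰ d)
    (hω : ∀ x y, brE (s x) (s y) = s (brL x y) + ι (ω x y)) (a b : Z22) (x y : L)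
    (hx : x ∈ 𝓛 a) (hy : y ∈ 𝓛 b) : ω x y ∈ 𝒱 (a + b) := by
  apply h.mem_of_ι_mem hV
  rw [← sub_eq_iff_eq_add'.mpr (hω x y)]
  exact sub_mem (h.lie.bracket_mem _ _ _ _ (hs _ _ hx) (hs _ _ hy))
    (hs _ _ (hL.bracket_mem _ _ _ _ hx hy))

/-- An extension with a graded section whose cocycle differs from `ω'` by the coboundary of a
graded linear form `f` is the extension defined by `ω'`. -/
theorem equivalent (h : IsGradedCentralExtension 𝓛 brL 𝒱 ℰ brE ι π)
    (hV : DirectSum.IsInternal 𝒱) (hπ : ∀ x, π (s x) = x) (hs : ∀ d x, x ∈ 𝓛 d → s x ∈ ℰ d)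
    (hω : ∀ x y, brE (s x) (s y) = s (brL x y) + ι (ω x y)) {ω' : L →ₗ[ℂ] L →ₗ[ℂ] V}
    {f : L →ₗ[ℂ] V} (hf : ∀ d x, x ∈ 𝓛 d → f x ∈ 𝒱 d) (hωf : ω = ω' + brL.compr₂ f) :
    ExtensionEquivalent ℰ brE ι π (extGrading 𝓛 𝒱) (extBracket brL ω')
      (LinearMap.inr ℂ L V) (LinearMap.fst ℂ L V) := by
  -- The equivalence is built in the inverse direction. Shifting the section by ι ∘ f absorbs the
  -- coboundary, so that ψ carries the bracket of ω' to that of E.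
  let ψ : L × V →ₗ[ℂ] E := (s + ι ∘ₗ f).coprod ι
  have hψ : ∀ x v, ψ (x, v) = s x + ι (f x) + ι v := fun x v => by simp [ψ]
  have hπψ : ∀ p, π (ψ p) = p.1 := fun ⟨x, v⟩ => by
    rw [hψ, map_add, map_add, hπ, h.π_ι, h.π_ι, add_zero, add_zero]
  have hinj : Function.Injective ψ := by
    rw [injective_iff_map_eq_zero]
    rintro ⟨x, v⟩ hp
    have hx : x = 0 := by simpa only [hp, map_zero] using (hπψ (x, v)).symm
    subst hx
    rw [hψ, map_zero, map_zero, map_zero, zero_add, zero_add] at hp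
    rw [h.injective (hp.trans (map_zero ι).symm)]
    rfl
  have hsurj : Function.Surjective ψ := fun e => by
    have : e - s (π e) ∈ LinearMap.range ι := by
      rw [h.exact, LinearMap.mem_ker, map_sub, hπ, sub_self]
    obtain ⟨v, hv⟩ := this
    exact ⟨(π e, v - f (π e)), by rw [hψ, map_sub, hv]; abel⟩
  let φ := LinearEquiv.ofBijective ψ ⟨hinj, hsurj⟩
  have hφ : ∀ e, ψ (φ.symm e) = e := φ.apply_symm_apply
  have hφ1 : ∀ e, (φ.symm e).1 = π e := fun e => by rw [← hπψ, hφ]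
  refine ⟨φ.symm, fun a e he => ?_, fun e₁ e₂ => ?_, fun v => ?_, hφ1⟩
  · have h1 : (φ.symm e).1 ∈ 𝓛 a := by rw [hφ1]; exact h.π_mem a e he
    refine ⟨h1, h.mem_of_ι_mem hV ?_⟩
    have h2 := hφ e
    rw [← Prod.mk.eta (p := φ.symm e), hψ] at h2
    rw [← sub_eq_iff_eq_add'.mpr h2.symm]
    exact sub_mem he (add_mem (hs _ _ h1) (h.ι_mem _ _ (hf _ _ h1)))
  · rw [LinearEquiv.symm_apply_eq]
    obtain ⟨⟨x, v⟩, rfl⟩ := hsurj e₁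
    obtain ⟨⟨y, w⟩, rfl⟩ := hsurj e₂
    have hsymm : ∀ p, φ.symm (ψ p) = p := φ.symm_apply_apply
    rw [hsymm, hsymm]
    show _ = ψ (brL x y, ω' x y)
    simp only [hψ, map_add, LinearMap.add_apply, h.central, h.central_left hV, add_zero, hω, hωf,
      LinearMap.compr₂_apply]
    abel
  · rw [LinearEquiv.symm_apply_eq]
    show ι v = ψ (0, v)
    rw [hψ, map_zero, map_zero, map_zero, zero_add, zero_add]

end IsGradedCentralExtension

/-! ### Equivalent extensions have cohomologous cocycles -/

section Equivalence

variable {L V E : Type*} [AddCommGroup L] [Module ℂ L] [AddCommGroup V] [Module ℂ V]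
  [AddCommGroup E] [Module ℂ E]
  {𝓛 : Z22 → Submodule ℂ L} {brL : L →ₗ[ℂ] L →ₗ[ℂ] L} {𝒱 : Z22 → Submodule ℂ V}
  {ℰ : Z22 → Submodule ℂ E} {brE : E →ₗ[ℂ] E →ₗ[ℂ] E} {ι : V →ₗ[ℂ] E} {π : E →ₗ[ℂ] L}

/-- Cocycles that define the same extension are cohomologous. -/
theorem ExtensionEquivalent.cohomologous {ω ω' : L →ₗ[ℂ] L →ₗ[ℂ] V}
    (h : ExtensionEquivalent ℰ brE ι π (extGrading 𝓛 𝒱) (extBracket brL ω)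
      (LinearMap.inr ℂ L V) (LinearMap.fst ℂ L V))
    (h' : ExtensionEquivalent ℰ brE ι π (extGrading 𝓛 𝒱) (extBracket brL ω')
      (LinearMap.inr ℂ L V) (LinearMap.fst ℂ L V)) :
    ∃ f : L →ₗ[ℂ] V, ∀ x y, ω x y = ω' x y + f (brL x y) := by
  obtain ⟨φ, -, hb, hι, hπ⟩ := h
  obtain ⟨φ', -, hb', hι', hπ'⟩ := h'
  let χ : L × V →ₗ[ℂ] L × V := (φ.symm.trans φ').toLinearMap
  have hχb : ∀ p q, χ (extBracket brL ω p q) = extBracket brL ω' (χ p) (χ q) := fun p q => by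
    have : φ.symm (extBracket brL ω p q) = brE (φ.symm p) (φ.symm q) := by
      rw [LinearEquiv.symm_apply_eq, hb, φ.apply_symm_apply, φ.apply_symm_apply]
    show φ' (φ.symm _) = _
    rw [this, hb']
    rfl
  have hχι : ∀ v, χ (0, v) = (0, v) := fun v => by
    have : φ.symm (0, v) = ι v := by
      rw [LinearEquiv.symm_apply_eq, hι]
      rfl
    show φ' (φ.symm _) = _
    rw [this, hι']
    rfl
  have hχ1 : ∀ p, (χ p).1 = p.1 := fun p => by
    have h1 := hπ' (φ.symm p)
    have h2 := hπ (φ.symm p)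
    rw [φ.apply_symm_apply] at h2
    exact h1.trans h2.symm
  -- An isomorphism compatible with both maps is a shear (x, v) ↦ (x, f x + v); comparing the
  -- V-components of brackets gives the coboundary.
  let f : L →ₗ[ℂ] V := LinearMap.snd ℂ L V ∘ₗ χ ∘ₗ LinearMap.inl ℂ L V
  have hχ : ∀ x v, χ (x, v) = (x, f x + v) := fun x v => by
    have : (x, v) = (x, 0) + (0, v) := by simp
    rw [this, map_add, hχι]
    ext
    · simp [hχ1]
    · simp [f]
  refine ⟨-f, fun x y => ?_⟩
  have h1 := congrArg Prod.snd (hχb (x, 0) (y, 0))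
  have h2 : extBracket brL ω (x, 0) (y, 0) = (brL x y, ω x y) := rfl
  rw [h2, hχ, hχ, hχ] at h1
  have h3 : f (brL x y) + ω x y = ω' x y := h1
  rw [← h3, LinearMap.neg_apply]
  abel

end Equivalence

/-! ### Central extensions of the loop algebra -/

namespace Osp

open Idx

/-- The basis vectors X^a_m are homogeneous, so homogeneous lifts of them extend linearly to a
graded section. -/
theorem exists_graded_section {V E : Type*} [AddCommGroup V] [Module ℂ V]
    [AddCommGroup E] [Module ℂ E] {𝒱 : Z22 → Submodule ℂ V}
    {ℰ : Z22 → Submodule ℂ E} {brE : E →ₗ[ℂ] E →ₗ[ℂ] E} {ι : V →ₗ[ℂ] E} {π : E →ₗ[ℂ] Loop}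
    (h : IsGradedCentralExtension loopGrading loopBracket 𝒱 ℰ brE ι π) :
    ∃ s : Loop →ₗ[ℂ] E, (∀ x, π (s x) = x) ∧ ∀ d x, x ∈ loopGrading d → s x ∈ ℰ d := by
  have := fun p : ℤ × Idx => h.exists_lift isInternal_loopGrading (XL_mem p.1 p.2)
  choose t ht hπ using this
  have hs : ∀ m a, loopBasis.constr ℂ t (XL m a) = t (m, a) := fun m a => by
    rw [← loopBasis_apply, Basis.constr_basis]
  refine ⟨loopBasis.constr ℂ t, fun x => ?_, fun d x hx => ?_⟩
  · have : π ∘ₗ loopBasis.constr ℂ t = LinearMap.id := loopBasis.ext fun ⟨m, a⟩ => by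
      rw [LinearMap.comp_apply, loopBasis_apply, hs, hπ, LinearMap.id_apply]
    exact LinearMap.congr_fun this x
  · refine loopGrading_induction (p := fun x => loopBasis.constr ℂ t x ∈ ℰ d) (fun m a ha => ?_)
      (by simp) (fun x x' hx hx' => ?_) (fun t x hx => ?_) hx
    · rw [hs, ← ha]
      exact ht (m, a)
    · rw [map_add]; exact add_mem hx hx'
    · rw [map_smul]; exact Submodule.smul_mem _ _ hx

section Extension

variable {V : Type*} [AddCommGroup V] [Module ℂ V] {𝒱 : Z22 → Submodule ℂ V}

theorem isGradedCentralExtension_affine (hV : DirectSum.IsInternal 𝒱) {u v : V}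
    (hu : u ∈ 𝒱 (0, 0)) (hv : v ∈ 𝒱 (1, 1)) :
    IsGradedCentralExtension loopGrading loopBracket 𝒱 (extGrading loopGrading 𝒱)
      (extBracket loopBracket (affineCocycle u v)) (LinearMap.inr ℂ Loop V)
      (LinearMap.fst ℂ Loop V) where
  lie :=
    { isInternal := isInternal_extGrading isInternal_loopGrading hV
      bracket_mem := fun a b x y hx hy =>
        ⟨isZ22LieSuperalgebra_loop.bracket_mem a b _ _ hx.1 hy.1,
          affineCocycle_mem hu hv a b _ _ hx.1 hy.1⟩
      skew := fun a b x y hx hy => Prod.ext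
        (isZ22LieSuperalgebra_loop.skew a b _ _ hx.1 hy.1)
        ((isCocycle_affineCocycle u v).skew a b _ _ hx.1 hy.1)
      jacobi := fun a b c x y z hx hy hz => Prod.ext
        (isZ22LieSuperalgebra_loop.jacobi a b c _ _ _ hx.1 hy.1 hz.1)
        ((isCocycle_affineCocycle u v).jacobi a b c _ _ _ hx.1 hy.1 hz.1) }
  ι_mem a v hv := ⟨zero_mem _, hv⟩
  π_mem a e he := he.1
  injective := LinearMap.inr_injective
  exact := LinearMap.range_inr ℂ Loop V
  surjective := LinearMap.fst_surjective
  map_bracket e e' := rfl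
  central e v := by
    show ((loopBracket e.1 0, affineCocycle _ _ e.1 0) : Loop × V) = 0
    rw [map_zero, map_zero]
    rfl

theorem existsUnique_extensionEquivalent (hV : DirectSum.IsInternal 𝒱) {E : Type*}
    [AddCommGroup E] [Module ℂ E]
    {ℰ : Z22 → Submodule ℂ E} {brE : E →ₗ[ℂ] E →ₗ[ℂ] E} {ι : V →ₗ[ℂ] E} {π : E →ₗ[ℂ] Loop}
    (h : IsGradedCentralExtension loopGrading loopBracket 𝒱 ℰ brE ι π) :
    ∃! p : 𝒱 (0, 0) × 𝒱 (1, 1),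
      ExtensionEquivalent ℰ brE ι π (extGrading loopGrading 𝒱)
        (extBracket loopBracket (affineCocycle (p.1 : V) (p.2 : V)))
        (LinearMap.inr ℂ Loop V) (LinearMap.fst ℂ Loop V) := by
  obtain ⟨s, hπ, hs⟩ := exists_graded_section h
  obtain ⟨ω, hω⟩ := h.exists_cocycle hπ
  have hmem := h.cocycle_mem hV isZ22LieSuperalgebra_loop hs hω
  have hcoc : IsCocycle ω := ⟨h.cocycle_skew isZ22LieSuperalgebra_loop hs hω,
    h.cocycle_jacobi isZ22LieSuperalgebra_loop hs hω⟩
  have hu : (12⁻¹ : ℂ) • ω (XL 1 R) (XL (-1) R) ∈ 𝒱 (0, 0) :=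
    Submodule.smul_mem _ _ (hmem (0, 0) (0, 0) _ _ (XL_mem 1 R) (XL_mem (-1) R))
  have hv : (12⁻¹ : ℂ) • ω (XL 1 R) (XL (-1) S) ∈ 𝒱 (1, 1) :=
    Submodule.smul_mem _ _ (hmem (0, 0) (1, 1) _ _ (XL_mem 1 R) (XL_mem (-1) S))
  have heq := h.equivalent hV hπ hs hω (fun d x hx => potential_mem hmem hx)
    hcoc.eq_affineCocycle_add
  refine ⟨(⟨_, hu⟩, ⟨_, hv⟩), heq, fun p hp => ?_⟩
  obtain ⟨f, hf⟩ := ExtensionEquivalent.cohomologous hp heq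
  obtain ⟨h1, h2⟩ := affineCocycle_injective hf
  exact Prod.ext (Subtype.ext h1) (Subtype.ext h2)

end Extension

/-! ### Scalar cocycles -/

theorem mem_cocycles {ω : Loop →ₗ[ℂ] Loop →ₗ[ℂ] ℂ} :
    ω ∈ cocycles loopGrading loopBracket ↔ IsCocycle ω :=
  ⟨fun h => ⟨h.1, h.2⟩, fun h => ⟨h.skew, h.jacobi⟩⟩

theorem hasDegree_of_basis {ω : Loop →ₗ[ℂ] Loop →ₗ[ℂ] ℂ} {c : Z22}
    (h : ∀ m a n b, deg a + deg b ≠ c → ω (XL m a) (XL n b) = 0) :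
    HasDegree loopGrading c ω := fun a b x y hx hy hab => by
  refine loopGrading_induction (p := fun x => ω x y = 0)
    (fun m i hi => ?_) (by simp) (fun x x' hx hx' => by simp [hx, hx'])
    (fun t x hx => by simp [hx]) hx
  refine loopGrading_induction (p := fun y => ω (XL m i) y = 0)
    (fun n j hj => ?_) (by simp) (fun x x' hx hx' => by simp [hx, hx'])
    (fun t x hx => by simp [hx]) hy
  exact h m i n j (by rwa [hi, hj])

theorem hasDegree_affineCocycle_zero_zero :
    HasDegree loopGrading (0, 0) (affineCocycle (1 : ℂ) 0) :=
  hasDegree_of_basis fun m a n b h => by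
    rw [affineCocycle_XL_eq, gTable_eq_zero a b fun e => h (by
      rw [e]; clear * -; revert b; decide)]
    simp

theorem hasDegree_affineCocycle_one_one :
    HasDegree loopGrading (1, 1) (affineCocycle (0 : ℂ) 1) :=
  hasDegree_of_basis fun m a n b h => by
    rw [affineCocycle_XL_eq, etaTable_eq_zero a b h]
    simp

theorem affineCocycle_eq_smul_add (t t' : ℂ) :
    affineCocycle t t' = t • affineCocycle (1 : ℂ) 0 + t' • affineCocycle (0 : ℂ) 1 := by
  refine loopBasis.ext fun ⟨m, a⟩ => loopBasis.ext fun ⟨n, b⟩ => ?_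
  simp only [loopBasis_apply, LinearMap.add_apply, LinearMap.smul_apply, affineCocycle_XL_eq]
  split_ifs
  · simp only [smul_eq_mul, zsmul_eq_mul]
    ring
  · simp

/-- The classes of the two affine cocycles. -/
noncomputable def affineClass : Fin 2 → H2 loopGrading loopBracket :=
  ![⟨(coboundaries loopBracket).mkQ (affineCocycle 1 0),
      Submodule.mem_map_of_mem (mem_cocycles.mpr (isCocycle_affineCocycle 1 0))⟩,
    ⟨(coboundaries loopBracket).mkQ (affineCocycle 0 1),
      Submodule.mem_map_of_mem (mem_cocycles.mpr (isCocycle_affineCocycle 0 1))⟩]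

theorem coe_smul_affineClass_add (t t' : ℂ) :
    ((t • affineClass 0 + t' • affineClass 1 : H2 loopGrading loopBracket) :
      (Loop →ₗ[ℂ] Loop →ₗ[ℂ] ℂ) ⧸ coboundaries loopBracket) =
      (coboundaries loopBracket).mkQ (affineCocycle t t') := by
  rw [affineCocycle_eq_smul_add, map_add, map_smul, map_smul]
  rfl

theorem linearIndependent_affineClass : LinearIndependent ℂ affineClass := by
  rw [Fintype.linearIndependent_iff]
  intro t ht
  rw [Fin.sum_univ_two] at ht
  have h : (coboundaries loopBracket).mkQ (affineCocycle (t 0) (t 1)) = 0 := by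
    rw [← coe_smul_affineClass_add, ht, Submodule.coe_zero]
  obtain ⟨f, hf⟩ := (Submodule.Quotient.mk_eq_zero _).mp h
  -- A combination that is a coboundary is cohomologous to the affine cocycle with both parameters
  -- 0.
  obtain ⟨h0, h1⟩ := affineCocycle_injective (u' := 0) (v' := 0) (f := f) fun x y => by
    rw [hf, affineCocycle_eq_smul_add 0 0]
    simp
  exact Fin.forall_fin_two.mpr ⟨h0, h1⟩

theorem span_affineClass : ⊤ ≤ Submodule.span ℂ (Set.range affineClass) := by
  rintro ⟨_, ω, hω, rfl⟩ -
  have h := (mem_cocycles.mp hω).eq_affineCocycle_add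
  set t := (12⁻¹ : ℂ) • ω (XL 1 R) (XL (-1) R)
  set t' := (12⁻¹ : ℂ) • ω (XL 1 R) (XL (-1) S)
  have : (⟨_, ω, hω, rfl⟩ : H2 loopGrading loopBracket) = t • affineClass 0 + t' • affineClass 1 := by
    apply Subtype.ext
    rw [coe_smul_affineClass_add]
    refine (Submodule.Quotient.eq _).mpr ⟨potential ω, fun x y => ?_⟩
    conv_lhs => rw [h]
    simp
  rw [this]
  exact add_mem (Submodule.smul_mem _ _ (Submodule.subset_span ⟨0, rfl⟩))
    (Submodule.smul_mem _ _ (Submodule.subset_span ⟨1, rfl⟩))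

end Osp

theorem mainTheorem1 :
    -- the loop algebra is a graded Lie superalgebra
    IsZ22LieSuperalgebra Osp.loopGrading Osp.loopBracket ∧
    -- classification of the graded central extensions by an arbitrary graded vector space
    (∀ (V : Type u) [AddCommGroup V] [Module ℂ V] (𝒱 : Z22 → Submodule ℂ V),
      DirectSum.IsInternal 𝒱 →
      (∀ ω₀₀ ∈ 𝒱 (0, 0), ∀ ω₁₁ ∈ 𝒱 (1, 1),
        IsGradedCentralExtension Osp.loopGrading Osp.loopBracket 𝒱
          (extGrading Osp.loopGrading 𝒱)
          (extBracket Osp.loopBracket (Osp.affineCocycle ω₀₀ ω₁₁))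
          (LinearMap.inr ℂ Osp.Loop V) (LinearMap.fst ℂ Osp.Loop V)) ∧
      (∀ (E : Type v) [AddCommGroup E] [Module ℂ E] (ℰ : Z22 → Submodule ℂ E)
        (brE : E →ₗ[ℂ] E →ₗ[ℂ] E) (ι : V →ₗ[ℂ] E) (π : E →ₗ[ℂ] Osp.Loop),
        IsGradedCentralExtension Osp.loopGrading Osp.loopBracket 𝒱 ℰ brE ι π →
        ∃! p : 𝒱 (0, 0) × 𝒱 (1, 1),
          ExtensionEquivalent ℰ brE ι π
            (extGrading Osp.loopGrading 𝒱)
            (extBracket Osp.loopBracket (Osp.affineCocycle (p.1 : V) (p.2 : V)))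
            (LinearMap.inr ℂ Osp.Loop V) (LinearMap.fst ℂ Osp.Loop V))) ∧
    -- exactly two independent classes, of degrees `(0,0)` and `(1,1)`
    HasDegree Osp.loopGrading (0, 0) (Osp.affineCocycle (1 : ℂ) 0) ∧
    HasDegree Osp.loopGrading (1, 1) (Osp.affineCocycle (0 : ℂ) 1) ∧
    Osp.affineCocycle (1 : ℂ) 0 ∈ cocycles Osp.loopGrading Osp.loopBracket ∧
    Osp.affineCocycle (0 : ℂ) 1 ∈ cocycles Osp.loopGrading Osp.loopBracket ∧
    ∃ b : Module.Basis (Fin 2) ℂ (H2 Osp.loopGrading Osp.loopBracket),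
      (b 0).val = (coboundaries Osp.loopBracket).mkQ (Osp.affineCocycle (1 : ℂ) 0) ∧
      (b 1).val = (coboundaries Osp.loopBracket).mkQ (Osp.affineCocycle (0 : ℂ) 1) :=
  ⟨Osp.isZ22LieSuperalgebra_loop,
    fun _ _ _ _ hV => ⟨fun _ hu _ hv => Osp.isGradedCentralExtension_affine hV hu hv,
      fun _ _ _ _ _ _ _ h => Osp.existsUnique_extensionEquivalent hV h⟩,
    Osp.hasDegree_affineCocycle_zero_zero, Osp.hasDegree_affineCocycle_one_one,
    Osp.mem_cocycles.mpr (Osp.isCocycle_affineCocycle 1 0),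
    Osp.mem_cocycles.mpr (Osp.isCocycle_affineCocycle 0 1),
    Basis.mk Osp.linearIndependent_affineClass Osp.span_affineClass,
    by rw [Basis.mk_apply]; rfl, by rw [Basis.mk_apply]; rfl⟩
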